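/- For $X\in\mathrm{Mat}_{n\times n}(\mathbb C)$ let $X_{\mathfrak k_n}$ be its projection onto $\mathfrak u(n)$ parallel to the upper triangular matrices with real diagonal. For $\lambda\in\mathbb R$ the Zakrzewski-type bracket $\{\,,\}_\lambda$ on $\mathrm{Mat}_{n\times d}(\mathbb C)$ (regarded as a real manifold) is the bracket on real-valued smooth functions, a derivation in each argument, given on linear functions $F(v)=\mathrm{Im}\,\mathrm{tr}(\xi^\dagger v)$, $H(v)=\mathrm{Im}\,\mathrm{tr}(\eta^\dagger v)$ by $$\{F,H\}_\lambda(v)=\mathrm{Im}\,\mathrm{tr}\bigl(v\xi^\dagger (v\eta^\dagger)_{\mathfrak k_n}+\xi^\dagger v(\eta^\dagger v)_{\mathfrak k_d}-v\xi^\dagger v\eta^\dagger-\lambda\,\xi^\dagger\eta\bigr),$$ where the trace of a sum is the sum of the traces of its terms, which may have different sizes. Let $M=\mathrm{Mat}_{n\times d_1}(\mathbb C)$ carry $\{\,,\}_\lambda$ and $N=\mathrm{Mat}_{n\times d_2}(\mathbb C)$ carry $\{\,,\}_\mu$ with $\mu=1$. Let $\Omega_\lambda=\{v\in M:\lambda+vv^\dagger>0\}$,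 which is all of $M$ if $\lambda>0$. For $v\in\Omega_\lambda$ there is a unique upper triangular matrix $b(v)$ with real positive diagonal entries such that $b(v)b(v)^\dagger=\lambda+vv^\dagger$. Put $$\Sigma(v;V)=(v,\,b(v)V)\in\tilde M=\mathrm{Mat}_{n\times(d_1+d_2)}(\mathbb C),\qquad v\in\Omega_\lambda,\ V\in N,$$ and let $\tilde\Omega_\lambda\subset\tilde M$ be the set of matrices whose first $d_1$ columns form an element of $\Omega_\lambda$. Then $\Sigma$ is a Poisson isomorphism (a diffeomorphism preserving Poisson brackets) from $\Omega_\lambda\times N$ with the direct sum Poisson bracket onto $\tilde\Omega_\lambda$ with the bracket $\{\,,\}_\lambda$ of $\tilde M$. Thus the Poisson bracket engendered on $\tilde\Omega_\lambda$ by $\Sigma$, that is, the unique one for which $\Sigma$ is a Poisson isomorphism, is given for $\tilde F(\tilde V)=\mathrm{Im}\,\mathrm{tr}(\tilde X^\dagger\tilde V)$, $\tilde H(\tilde V)=\mathrm{Im}\,\mathrm{tr}(\tilde Y^\dagger\tilde V)$ by $$\{\tilde F,\tilde H\}(\tilde V)=\mathrm{Im}\,\mathrm{tr}\bigl(\tilde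 V\tilde X^\dagger(\tilde V\tilde Y^\dagger)_{\mathfrak k_n}+\tilde X^\dagger\tilde V(\tilde Y^\dagger\tilde V)_{\mathfrak k_{d_1+d_2}}-\tilde V\tilde X^\dagger\tilde V\tilde Y^\dagger-\lambda\tilde X^\dagger\tilde Y\bigr).$$ In particular, if $\lambda>0$, then $\Sigma:M\times N\to\tilde M$ is a Poisson isomorphism onto all of $\tilde M$. -/

import Mathlib

open scoped ContDiff ComplexOrder Matrix

/- Norms on matrix spaces are used only to speak of smooth maps and derivatives; all norms on these
finite-dimensional spaces are equivalent. -/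
attribute [local instance] Matrix.normedAddCommGroup Matrix.normedSpace

namespace ZakPoisson

noncomputable section

/-- The real vector space of complex `n × d` matrices. -/
abbrev Mat (n d : ℕ) : Type := Matrix (Fin n) (Fin d) ℂ

/-! ### The splitting `gl(n, ℂ) = u(n) ⊕ b(n)` -/

/-- `u(n)`: the skew-Hermitian matrices. -/
def InU {n : ℕ} (X : Mat n n) : Prop := X + Xᴴ = 0

/-- `b(n)`: the upper triangular matrices with real diagonal. -/
def InB {n : ℕ} (X : Mat n n) : Prop :=
  (∀ i j, j < i → X i j = 0) ∧ ∀ i, (X i i).im = 0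

/-- The projection `X ↦ X_𝔨` of `gl(n, ℂ)` onto `u(n)` parallel to `b(n)`. -/
def projU {n : ℕ} (X : Mat n n) : Mat n n :=
  Matrix.of fun i j =>
    if j < i then X i j
    else if i < j then -star (X j i)
    else ((X i i).im : ℂ) * Complex.I

/-- `projU` is the projection onto `u(n)` parallel to `b(n)`: `projU X` is the only skew-Hermitian
matrix which differs from `X` by an element of `b(n)`. -/
theorem projU_eq_iff {n : ℕ} (X K : Mat n n) : projU X = K ↔ InU K ∧ InB (X - K) := by
  constructor
  · rintro rfl
    refine ⟨?_, ?_, ?_⟩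
    · ext i j
      rcases lt_trichotomy i j with h | h | h
      · simp [projU, h, h.not_gt]
      · subst h
        simp [projU]
      · simp [projU, h, h.not_gt]
    · intro i j h
      simp [projU, h]
    · intro i
      simp [projU]
  · rintro ⟨hK, h1, h2⟩
    have hK' : ∀ i j, K i j + star (K j i) = 0 := fun i j => by
      simpa using congrFun (congrFun hK i) j
    ext i j
    rcases lt_trichotomy i j with h | h | h
    · have e : X j i = K j i := by simpa [sub_eq_zero] using h1 j i h
      simp only [projU, Matrix.of_apply, h, h.not_gt, if_false, if_true, e]
      exact (eq_neg_of_add_eq_zero_left (hK' i j)).symm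
    · subst h
      have e : (X i i).im = (K i i).im := by simpa [sub_eq_zero] using h2 i
      have r : (K i i).re = 0 := by
        have := congrArg Complex.re (hK' i i)
        simp at this
        linarith
      apply Complex.ext <;> simp [projU, e, r]
    · simpa [projU, h, sub_eq_zero] using h1 i j h

/-- The group `B(n)`: upper triangular matrices with real positive diagonal entries. -/
def BorelGroup (n : ℕ) : Set (Mat n n) :=
  {b | (∀ i j, j < i → b i j = 0) ∧ ∀ i, (b i i).im = 0 ∧ 0 < (b i i).re}

/-! ### The Zakrzewski bracket -/

/-- The differential `δ_v F` of `F : Mat_{n×d}(ℂ) → ℝ` as a `d × n` matrix, under the real pairing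
`(ξ, w) ↦ Im tr (ξ w)`. -/
def diff {n d : ℕ} (F : Mat n d → ℝ) (v : Mat n d) : Mat d n :=
  Matrix.of fun j i =>
    (fderiv ℝ F v (Matrix.single i j Complex.I) : ℂ) +
      (fderiv ℝ F v (Matrix.single i j 1) : ℂ) * Complex.I

theorem fderiv_eq_im_trace {n d : ℕ} (F : Mat n d → ℝ) (v w : Mat n d) :
    fderiv ℝ F v w = (Matrix.trace (diff F v * w)).im := by
  have hw : w = ∑ i, ∑ j, ((w i j).re • Matrix.single i j (1 : ℂ) +
      (w i j).im • Matrix.single i j Complex.I) := by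
    conv_lhs => rw [Matrix.matrix_eq_sum_single w]
    refine Finset.sum_congr rfl fun i _ => Finset.sum_congr rfl fun j _ => ?_
    rw [Matrix.smul_single, Matrix.smul_single, ← Matrix.single_add]
    congr 1
    apply Complex.ext <;> simp
  conv_lhs => rw [hw]
  simp only [map_sum, map_add, map_smul, smul_eq_mul, Matrix.trace, Matrix.diag_apply,
    Matrix.mul_apply, Complex.im_sum, diff, Matrix.of_apply]
  rw [Finset.sum_comm]
  refine Finset.sum_congr rfl fun j _ => Finset.sum_congr rfl fun i _ => ?_
  simp
  ring

/-- The value at `v` of the Zakrzewski bivector with parameter `lam` on the covectors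
`w ↦ Im tr (x w)` and `w ↦ Im tr (y w)`; here `x = ξ†`, `y = η†`. -/
def zakBivector {n d : ℕ} (lam : ℝ) (v : Mat n d) (x y : Mat d n) : ℝ :=
  (Matrix.trace (v * x * projU (v * y))).im + (Matrix.trace (x * v * projU (y * v))).im
    - (Matrix.trace (x * v * y * v)).im - lam * (Matrix.trace (x * yᴴ)).im

/-- The Zakrzewski bracket with parameter `lam` on `Mat_{n×d}(ℂ)`. -/
def zakBracket (n d : ℕ) (lam : ℝ) (F H : Mat n d → ℝ) : Mat n d → ℝ := fun v =>
  zakBivector lam v (diff F v) (diff H v)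

/-- The direct sum of two brackets, on a product. -/
def directSumBracket {E E' : Type*} (br : (E → ℝ) → (E → ℝ) → E → ℝ)
    (br' : (E' → ℝ) → (E' → ℝ) → E' → ℝ) (F H : E × E' → ℝ) : E × E' → ℝ := fun p =>
  br (fun m => F (m, p.2)) (fun m => H (m, p.2)) p.1 +
    br' (fun m => F (p.1, m)) (fun m => H (p.1, m)) p.2

/-- The real-linear function `W ↦ Im tr (X† W)`. -/
def linFun {n d : ℕ} (X : Mat n d) : Mat n d → ℝ := fun W => (Matrix.trace (Xᴴ * W)).im

/-! ### Poisson brackets and Poisson isomorphisms -/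

variable {E E' : Type*} [NormedAddCommGroup E] [NormedSpace ℝ E]
  [NormedAddCommGroup E'] [NormedSpace ℝ E']

/-- `br` is a Poisson bracket on `C^∞(U)`, with `U` an open subset of a normed space. Smooth functions
on `U` are represented by functions on the whole space that are smooth on `U`; their values outside
`U` are irrelevant. -/
structure IsPoissonBracketOn (U : Set E) (br : (E → ℝ) → (E → ℝ) → E → ℝ) : Prop where
  isOpen : IsOpen U
  smooth : ∀ F H, ContDiffOn ℝ ∞ F U → ContDiffOn ℝ ∞ H U → ContDiffOn ℝ ∞ (br F H) U
  congr : ∀ F F' H, ContDiffOn ℝ ∞ F U → ContDiffOn ℝ ∞ F' U → ContDiffOn ℝ ∞ H U →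
    Set.EqOn F F' U → Set.EqOn (br F H) (br F' H) U
  add : ∀ F G H, ContDiffOn ℝ ∞ F U → ContDiffOn ℝ ∞ G U → ContDiffOn ℝ ∞ H U →
    ∀ x ∈ U, br (F + G) H x = br F H x + br G H x
  smul : ∀ (c : ℝ) F H, ContDiffOn ℝ ∞ F U → ContDiffOn ℝ ∞ H U →
    ∀ x ∈ U, br (c • F) H x = c * br F H x
  skew : ∀ F H, ContDiffOn ℝ ∞ F U → ContDiffOn ℝ ∞ H U → ∀ x ∈ U, br F H x = -br H F x
  leibniz : ∀ F G H, ContDiffOn ℝ ∞ F U → ContDiffOn ℝ ∞ G U → ContDiffOn ℝ ∞ H U →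
    ∀ x ∈ U, br (F * G) H x = F x * br G H x + G x * br F H x
  jacobi : ∀ F G H, ContDiffOn ℝ ∞ F U → ContDiffOn ℝ ∞ G U → ContDiffOn ℝ ∞ H U →
    ∀ x ∈ U, br F (br G H) x + br G (br H F) x + br H (br F G) x = 0

/-- `Φ` restricts to a diffeomorphism of `U` onto `U'` that is a Poisson map, where `U` and `U'` carry
the Poisson brackets `br` and `br'`. -/
structure IsPoissonIso (U : Set E) (br : (E → ℝ) → (E → ℝ) → E → ℝ)
    (U' : Set E') (br' : (E' → ℝ) → (E' → ℝ) → E' → ℝ) (Φ : E → E') : Prop where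
  source : IsPoissonBracketOn U br
  target : IsPoissonBracketOn U' br'
  bijOn : Set.BijOn Φ U U'
  smooth : ContDiffOn ℝ ∞ Φ U
  smooth_inv : ∃ Ψ : E' → E, Set.LeftInvOn Ψ Φ U ∧ ContDiffOn ℝ ∞ Ψ U'
  map_bracket : ∀ F H, ContDiffOn ℝ ∞ F U' → ContDiffOn ℝ ∞ H U' →
    ∀ x ∈ U, br (F ∘ Φ) (H ∘ Φ) x = br' F H (Φ x)

/-! ### The map `Σ` -/

/-- `λ + v v†`. -/
def momentum {n d : ℕ} (lam : ℝ) (v : Mat n d) : Mat n n := (lam : ℂ) • (1 : Mat n n) + v * vᴴ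

/-- The open set where `λ + v v†` is positive definite. -/
def posDomain (n d : ℕ) (lam : ℝ) : Set (Mat n d) := {v | (momentum lam v).PosDef}

open Classical in
/-- The element `b(v)` of `B(n)` with `b(v) b(v)† = λ + v v†` (and `0` if there is none). -/
def bOf {n d : ℕ} (lam : ℝ) (v : Mat n d) : Mat n n :=
  if h : ∃ b ∈ BorelGroup n, b * bᴴ = momentum lam v then h.choose else 0

/-- The concatenation `(v, V)`, with the columns of `v` first. -/
def concat {n d₁ d₂ : ℕ} (v : Mat n d₁) (V : Mat n d₂) : Mat n (d₁ + d₂) :=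
  Matrix.of fun i => Fin.append (v i) (V i)

/-- The first `d₁` columns. -/
def leftBlock {n d₁ d₂ : ℕ} (W : Mat n (d₁ + d₂)) : Mat n d₁ :=
  Matrix.of fun i j => W i (Fin.castAdd d₂ j)

/-- The map `Σ(v; V) = (v, b(v) V)`. -/
def sigmaMap (n d₁ d₂ : ℕ) (lam : ℝ) (p : Mat n d₁ × Mat n d₂) : Mat n (d₁ + d₂) :=
  concat p.1 (bOf lam p.1 * p.2)

end

end ZakPoisson

/-!
The map `Σ` intertwines the two brackets because of an identity between bivectors, and everything
else is the verification that its ingredients make sense.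

**Brackets.** A bivector field is encoded by its anchor map, which sends a covector to its Hamiltonian
vector. A smooth skew anchor that satisfies the Jacobi identity on constant covectors defines a Poisson
bracket on every open set (`PoissonAnchor.isPoissonBracketOn`), and products of such anchors are again
of this kind (`PoissonAnchor.prod`). For the Zakrzewski bivector (`zakSharp_poissonAnchor`), write
`⟨A, B⟩ = Im tr (A B)`. As `u(n)` and `b(n)` are isotropic subalgebras for this pairing, `A ↦ A_𝔨`
satisfies a Yang-Baxter identity (`projU_cyclic`); it evaluates the Jacobi sum on the `n × n` side to
`⟨[a, b], c⟩` with `a = v x`, `b = v y`, `c = v z`, and on the `d × d` side to the same number with the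
opposite sign. The mixed terms cancel cyclically, and the terms with the parameter pair elements of
`u(n)` with each other.

**The factor `b`.** Existence comes from the LDL decomposition, uniqueness from the fact that an upper
triangular unitary matrix with positive diagonal is `1`, and smoothness from the inverse function
theorem for `X ↦ X X† + X_𝔨` on all matrices, whose value separates into a Hermitian and a
skew-Hermitian part (`eventually_bOf`). This also shows that the domain is open.

**The Poisson property.** The derivative `β` of `b` lies in `b(n)`, and the Hermitian part of `b⁻¹ β` is
known from `b b† = λ + v v†`. Hence the pullback by `Σ` of a covector with components `(x, X)` has
components `(x + v† Q, X b)` with `Q = b⁻† (V X b)_𝔨 b⁻¹` (`diff_comp_sigmaMap`). Inserting this into the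
two bivectors gives the bivector of the concatenated matrix (`zakBivector_pullback`): the equation
`v v† Q = b (V X b)_𝔨 b⁻¹ - λ Q` makes the terms with `λ` cancel, and conjugation by `b` preserves
`b(n)`. A bracket transported by the bijection `Σ` is unique, which gives the last assertion.
-/

namespace ZakPoisson

/-! ### Poisson brackets from anchor maps -/

section Anchor

variable {E E' : Type*} [NormedAddCommGroup E] [NormedSpace ℝ E]
  [NormedAddCommGroup E'] [NormedSpace ℝ E']

/-- A Poisson bivector field on `E`, encoded by its anchor map: `S v f` is the Hamiltonian vector at
`v` of the covector `f`, so that the bracket is `{F, H}(v) = dH_v (S v dF_v)`. The Jacobi identity is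
required for constant covectors only. -/
structure PoissonAnchor (S : E → (E →L[ℝ] ℝ) → E) : Prop where
  contDiff : ContDiff ℝ ∞ fun p : E × (E →L[ℝ] ℝ) => S p.1 p.2
  map_add : ∀ v f g, S v (f + g) = S v f + S v g
  map_smul : ∀ v (c : ℝ) f, S v (c • f) = c • S v f
  skew : ∀ (v : E) (f g : E →L[ℝ] ℝ), g (S v f) = -f (S v g)
  jacobi : ∀ (v : E) (f g h : E →L[ℝ] ℝ), h (fderiv ℝ (fun u => S u g) v (S v f)) +
    f (fderiv ℝ (fun u => S u h) v (S v g)) + g (fderiv ℝ (fun u => S u f) v (S v h)) = 0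

namespace PoissonAnchor

variable {S : E → (E →L[ℝ] ℝ) → E}

/-- The anchor at a point, as a continuous linear map. -/
def toCLM (hS : PoissonAnchor S) (v : E) : (E →L[ℝ] ℝ) →L[ℝ] E where
  toFun := S v
  map_add' := hS.map_add v
  map_smul' := hS.map_smul v
  cont := (hS.contDiff.continuous.comp (Continuous.prodMk_right v) :)

theorem differentiableAt_left (hS : PoissonAnchor S) (v : E) (f : E →L[ℝ] ℝ) :
    DifferentiableAt ℝ (fun u => S u f) v := by
  have h : ContDiff ℝ ∞ fun u => S u f :=
    hS.contDiff.comp (contDiff_id.prodMk contDiff_const)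
  exact h.differentiable (by simp) v

/-- The product rule for the Hamiltonian vector field of a covector field. -/
theorem fderiv_apply (hS : PoissonAnchor S) {α : E → E →L[ℝ] ℝ} {v : E}
    (hα : DifferentiableAt ℝ α v) :
    DifferentiableAt ℝ (fun u => S u (α u)) v ∧ ∀ w,
      fderiv ℝ (fun u => S u (α u)) v w =
        fderiv ℝ (fun u => S u (α v)) v w + S v (fderiv ℝ α v w) := by
  have h0 : HasFDerivAt (fun p : E × (E →L[ℝ] ℝ) => S p.1 p.2)
      (fderiv ℝ (fun p : E × (E →L[ℝ] ℝ) => S p.1 p.2) (v, α v)) (v, α v) :=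
    (hS.contDiff.differentiable (by simp) _).hasFDerivAt
  set S' := fderiv ℝ (fun p : E × (E →L[ℝ] ℝ) => S p.1 p.2) (v, α v)
  have h1 : HasFDerivAt (fun u => S u (α u))
      (S'.comp ((ContinuousLinearMap.id ℝ E).prod (fderiv ℝ α v))) v :=
    HasFDerivAt.comp (f := fun u => (u, α u)) v h0 ((hasFDerivAt_id v).prodMk hα.hasFDerivAt)
  have h2 : HasFDerivAt (fun u => S u (α v))
      (S'.comp ((ContinuousLinearMap.id ℝ E).prod 0)) v :=
    HasFDerivAt.comp (f := fun u => (u, α v)) v h0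
      ((hasFDerivAt_id v).prodMk (hasFDerivAt_const _ v))
  have h3 : HasFDerivAt (fun k => S v k)
      (S'.comp ((0 : (E →L[ℝ] ℝ) →L[ℝ] E).prod (ContinuousLinearMap.id ℝ _))) (α v) :=
    HasFDerivAt.comp (f := fun k => (v, k)) (α v) h0
      ((hasFDerivAt_const _ _).prodMk (hasFDerivAt_id _))
  have h4 : HasFDerivAt (fun k => S v k) (hS.toCLM v) (α v) := (hS.toCLM v).hasFDerivAt
  refine ⟨h1.differentiableAt, fun w => ?_⟩
  have h5 : S v (fderiv ℝ α v w) = S' (0, fderiv ℝ α v w) :=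
    DFunLike.congr_fun (h4.unique h3) (fderiv ℝ α v w)
  rw [h1.fderiv, h2.fderiv, h5]
  simp [← _root_.map_add]

/-- A bracket that is given on an open set by an anchor map is a Poisson bracket there. In the Jacobi
identity the second derivatives of the three functions cancel by their symmetry and the skewness of
the anchor. -/
theorem isPoissonBracketOn (hS : PoissonAnchor S) {U : Set E} (hU : IsOpen U)
    {br : (E → ℝ) → (E → ℝ) → E → ℝ}
    (hbr : ∀ F H, ContDiffOn ℝ ∞ F U → ContDiffOn ℝ ∞ H U → ∀ x ∈ U,
      br F H x = fderiv ℝ H x (S x (fderiv ℝ F x))) :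
    IsPoissonBracketOn U br := by
  have hd : ∀ {F : E → ℝ}, ContDiffOn ℝ ∞ F U → ContDiffOn ℝ ∞ (fderiv ℝ F) U := fun hF =>
    hF.fderiv_of_isOpen hU (by simp)
  have hda : ∀ {F : E → ℝ}, ContDiffOn ℝ ∞ F U → ∀ x ∈ U, DifferentiableAt ℝ F x :=
    fun hF x hx => (hF.contDiffAt (hU.mem_nhds hx)).differentiableAt (by simp)
  have hdd : ∀ {F : E → ℝ}, ContDiffOn ℝ ∞ F U → ∀ x ∈ U, DifferentiableAt ℝ (fderiv ℝ F) x :=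
    fun hF x hx => ((hd hF).contDiffAt (hU.mem_nhds hx)).differentiableAt (by simp)
  have hsm : ∀ F H, ContDiffOn ℝ ∞ F U → ContDiffOn ℝ ∞ H U → ContDiffOn ℝ ∞ (br F H) U := by
    intro F H hF hH
    refine ContDiffOn.congr ?_ (hbr F H hF hH)
    refine (hd hH).clm_apply ?_
    exact hS.contDiff.comp_contDiffOn (contDiffOn_id.prodMk (hd hF))
  have hjac : ∀ F G H, ContDiffOn ℝ ∞ F U → ContDiffOn ℝ ∞ G U → ContDiffOn ℝ ∞ H U →
      ∀ x ∈ U, br F (br G H) x =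
        fderiv ℝ (fderiv ℝ H) x (S x (fderiv ℝ F x)) (S x (fderiv ℝ G x)) -
        fderiv ℝ (fderiv ℝ G) x (S x (fderiv ℝ F x)) (S x (fderiv ℝ H x)) +
        fderiv ℝ H x (fderiv ℝ (fun u => S u (fderiv ℝ G x)) x (S x (fderiv ℝ F x))) := by
    intro F G H hF hG hH x hx
    rw [hbr F _ hF (hsm G H hG hH) x hx]
    have he : br G H =ᶠ[nhds x] fun y => fderiv ℝ H y (S y (fderiv ℝ G y)) := by
      filter_upwards [hU.mem_nhds hx] with y hy using hbr G H hG hH y hy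
    obtain ⟨h1, h2⟩ := hS.fderiv_apply (hdd hG x hx)
    rw [he.fderiv_eq, fderiv_clm_apply (hdd hH x hx) h1]
    simp only [_root_.add_apply, ContinuousLinearMap.comp_apply,
      ContinuousLinearMap.flip_apply, h2, _root_.map_add]
    rw [hS.skew x (fderiv ℝ (fderiv ℝ G) x (S x (fderiv ℝ F x))) (fderiv ℝ H x)]
    ring
  have hsymm : ∀ {F : E → ℝ}, ContDiffOn ℝ ∞ F U → ∀ x ∈ U, ∀ v w,
      fderiv ℝ (fderiv ℝ F) x v w = fderiv ℝ (fderiv ℝ F) x w v := fun hF x hx v w =>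
    ((hF.contDiffAt (hU.mem_nhds hx)).isSymmSndFDerivAt
      (by rw [minSmoothness_of_isRCLikeNormedField]; exact WithTop.coe_le_coe.2 le_top)).eq v w
  refine ⟨hU, hsm, ?_, ?_, ?_, ?_, ?_, ?_⟩
  · intro F F' H hF hF' hH he x hx
    have : fderiv ℝ F x = fderiv ℝ F' x :=
      (Filter.eventuallyEq_of_mem (hU.mem_nhds hx) he).fderiv_eq
    rw [hbr F H hF hH x hx, hbr F' H hF' hH x hx, this]
  · intro F G H hF hG hH x hx
    rw [hbr (F + G) H (hF.add hG) hH x hx, hbr F H hF hH x hx, hbr G H hG hH x hx,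
      fderiv_add (hda hF x hx) (hda hG x hx), hS.map_add, _root_.map_add]
  · intro c F H hF hH x hx
    rw [hbr (c • F) H (hF.const_smul c) hH x hx, hbr F H hF hH x hx,
      fderiv_const_smul (hda hF x hx), hS.map_smul, _root_.map_smul, smul_eq_mul]
  · intro F H hF hH x hx
    rw [hbr F H hF hH x hx, hbr H F hH hF x hx, hS.skew]
  · intro F G H hF hG hH x hx
    rw [hbr (F * G) H (hF.mul hG) hH x hx, hbr F H hF hH x hx, hbr G H hG hH x hx,
      fderiv_mul (hda hF x hx) (hda hG x hx), hS.map_add, hS.map_smul, hS.map_smul]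
    simp
  · intro F G H hF hG hH x hx
    rw [hjac F G H hF hG hH x hx, hjac G H F hG hH hF x hx, hjac H F G hH hF hG x hx]
    have := hS.jacobi x (fderiv ℝ F x) (fderiv ℝ G x) (fderiv ℝ H x)
    rw [hsymm hF x hx (S x (fderiv ℝ G x)), hsymm hG x hx (S x (fderiv ℝ H x)),
      hsymm hH x hx (S x (fderiv ℝ F x))]
    linarith

theorem prod (hS : PoissonAnchor S) {S' : E' → (E' →L[ℝ] ℝ) → E'} (hS' : PoissonAnchor S') :
    PoissonAnchor fun (p : E × E') (f : E × E' →L[ℝ] ℝ) =>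
      (S p.1 (f.comp (.inl ℝ E E')), S' p.2 (f.comp (.inr ℝ E E'))) := by
  have hfd : ∀ (p : E × E') (f : E →L[ℝ] ℝ) (f' : E' →L[ℝ] ℝ) (w : E × E'),
      fderiv ℝ (fun q : E × E' => (S q.1 f, S' q.2 f')) p w =
        (fderiv ℝ (fun u => S u f) p.1 w.1, fderiv ℝ (fun u => S' u f') p.2 w.2) := by
    intro p f f' w
    have h1 : HasFDerivAt (fun q : E × E' => S q.1 f) _ p :=
      HasFDerivAt.comp p (hS.differentiableAt_left p.1 f).hasFDerivAt hasFDerivAt_fst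
    have h2 : HasFDerivAt (fun q : E × E' => S' q.2 f') _ p :=
      HasFDerivAt.comp p (hS'.differentiableAt_left p.2 f').hasFDerivAt hasFDerivAt_snd
    rw [(h1.prodMk h2).fderiv]
    simp
  have hsplit : ∀ (f : E × E' →L[ℝ] ℝ) (a : E) (b : E'),
      f (a, b) = f.comp (.inl ℝ E E') a + f.comp (.inr ℝ E E') b := by
    intro f a b
    simp [← _root_.map_add]
  refine ⟨?_, ?_, ?_, ?_, ?_⟩
  · have e1 : ContDiff ℝ ∞ fun p : (E × E') × (E × E' →L[ℝ] ℝ) => p.2.comp (.inl ℝ E E') :=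
      contDiff_snd.clm_comp contDiff_const
    have e2 : ContDiff ℝ ∞ fun p : (E × E') × (E × E' →L[ℝ] ℝ) => p.2.comp (.inr ℝ E E') :=
      contDiff_snd.clm_comp contDiff_const
    exact (hS.contDiff.comp (contDiff_fst.fst.prodMk e1)).prodMk
      (hS'.contDiff.comp (contDiff_fst.snd.prodMk e2))
  · intro v f g
    simp [ContinuousLinearMap.add_comp, hS.map_add, hS'.map_add]
  · intro v c f
    simp [ContinuousLinearMap.smul_comp, hS.map_smul, hS'.map_smul]
  · intro v f g
    rw [hsplit, hsplit f, hS.skew, hS'.skew]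
    ring
  · intro v f g h
    simp only [hfd]
    rw [hsplit h, hsplit f, hsplit g]
    have h1 := hS.jacobi v.1 (f.comp (.inl ℝ E E')) (g.comp (.inl ℝ E E')) (h.comp (.inl ℝ E E'))
    have h2 := hS'.jacobi v.2 (f.comp (.inr ℝ E E')) (g.comp (.inr ℝ E E'))
      (h.comp (.inr ℝ E E'))
    linarith

end PoissonAnchor

end Anchor

/-! ### The pairing `Im tr (A B)` and the splitting of `gl(n, ℂ)` -/

section Pairing

variable {n d k : ℕ}

/-- The real-linear form `A ↦ Im tr A` on square matrices. -/
noncomputable def imTr (A : Mat n n) : ℝ := (Matrix.trace A).im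

theorem imTr_add (A B : Mat n n) : imTr (A + B) = imTr A + imTr B := by
  simp [imTr, Matrix.trace_add]

theorem imTr_sub (A B : Mat n n) : imTr (A - B) = imTr A - imTr B := by
  simp [imTr, Matrix.trace_sub]

theorem imTr_neg (A : Mat n n) : imTr (-A) = -imTr A := by
  simp [imTr, Matrix.trace_neg]

theorem imTr_smul (c : ℝ) (A : Mat n n) : imTr (c • A) = c * imTr A := by
  simp [imTr, Matrix.trace_smul]

theorem imTr_mul_comm (A : Mat n d) (B : Mat d n) : imTr (A * B) = imTr (B * A) := by
  rw [imTr, imTr, Matrix.trace_mul_comm]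

theorem imTr_conjTranspose (A : Mat n n) : imTr Aᴴ = -imTr A := by
  simp [imTr, Matrix.trace_conjTranspose]

theorem imTr_mul_rotate (A : Mat n d) (B : Mat d k) (C : Mat k n) :
    imTr (A * B * C) = imTr (C * A * B) := by
  rw [imTr_mul_comm, Matrix.mul_assoc]

theorem InU.conjTranspose_eq {K : Mat n n} (hK : InU K) : Kᴴ = -K :=
  (neg_eq_of_add_eq_zero_right hK).symm

theorem inU_iff {K : Mat n n} : InU K ↔ Kᴴ = -K :=
  ⟨InU.conjTranspose_eq, fun h => by rw [InU, h, add_neg_cancel]⟩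

/-- Conjugation by a matrix and its adjoint preserves `u(n)`. -/
theorem InU.conj {K : Mat n n} (hK : InU K) (A : Mat d n) : InU (A * K * Aᴴ) := by
  rw [inU_iff, Matrix.conjTranspose_mul, Matrix.conjTranspose_mul, hK.conjTranspose_eq,
    Matrix.conjTranspose_conjTranspose]
  simp [Matrix.mul_assoc]

theorem inU_sub_conjTranspose (A : Mat n n) : InU (A - Aᴴ) := by
  rw [inU_iff, Matrix.conjTranspose_sub, Matrix.conjTranspose_conjTranspose, neg_sub]

theorem InB.add {A B : Mat n n} (hA : InB A) (hB : InB B) : InB (A + B) :=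
  ⟨fun i j h => by simp [hA.1 i j h, hB.1 i j h], fun i => by simp [hA.2 i, hB.2 i]⟩

/-- The diagonal of a product of upper triangular matrices is the product of the diagonals. -/
theorem mul_diag_of_upper {A B : Mat n n} (hA : ∀ i j, j < i → A i j = 0)
    (hB : ∀ i j, j < i → B i j = 0) (i : Fin n) : (A * B) i i = A i i * B i i := by
  rw [Matrix.mul_apply]
  refine Finset.sum_eq_single_of_mem i (Finset.mem_univ i) fun j _ hj => ?_
  rcases lt_or_gt_of_ne hj with h | h
  · rw [hA i j h, zero_mul]
  · rw [hB j i h, mul_zero]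

theorem mul_upper {A B : Mat n n} (hA : ∀ i j, j < i → A i j = 0)
    (hB : ∀ i j, j < i → B i j = 0) (i j : Fin n) (h : j < i) : (A * B) i j = 0 := by
  rw [Matrix.mul_apply]
  refine Finset.sum_eq_zero fun l _ => ?_
  rcases lt_or_ge l i with hl | hl
  · rw [hA i l hl, zero_mul]
  · rw [hB l j (h.trans_le hl), mul_zero]

theorem InB.mul {A B : Mat n n} (hA : InB A) (hB : InB B) : InB (A * B) :=
  ⟨mul_upper hA.1 hB.1, fun i => by
    rw [mul_diag_of_upper hA.1 hB.1, Complex.mul_im, hA.2, hB.2]; simp⟩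

theorem InB.imTr_eq_zero {A : Mat n n} (hA : InB A) : imTr A = 0 := by
  simp [imTr, Matrix.trace, hA.2]

theorem InB.imTr_mul {A B : Mat n n} (hA : InB A) (hB : InB B) : imTr (A * B) = 0 :=
  (hA.mul hB).imTr_eq_zero

theorem InU.imTr_mul {A B : Mat n n} (hA : InU A) (hB : InU B) : imTr (A * B) = 0 := by
  have h := imTr_conjTranspose (A * B)
  rw [Matrix.conjTranspose_mul, hA.conjTranspose_eq, hB.conjTranspose_eq, neg_mul_neg,
    imTr_mul_comm] at h
  linarith

theorem InU.imTr_mul_conjTranspose {K : Mat n n} (hK : InU K) (A : Mat n n) :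
    imTr (K * Aᴴ) = imTr (K * A) := by
  have h := imTr_conjTranspose (A * K)
  rw [Matrix.conjTranspose_mul, hK.conjTranspose_eq, neg_mul, imTr_neg, imTr_mul_comm A] at h
  linarith

theorem projU_inU (X : Mat n n) : InU (projU X) := ((projU_eq_iff X _).1 rfl).1

theorem sub_projU_inB (X : Mat n n) : InB (X - projU X) := ((projU_eq_iff X _).1 rfl).2

theorem InU.projU_eq {K : Mat n n} (hK : InU K) : projU K = K :=
  (projU_eq_iff K K).2 ⟨hK, by simp [InB]⟩

theorem projU_add (X Y : Mat n n) : projU (X + Y) = projU X + projU Y := by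
  refine (projU_eq_iff _ _).2 ⟨?_, ?_⟩
  · rw [inU_iff, Matrix.conjTranspose_add, (projU_inU X).conjTranspose_eq,
      (projU_inU Y).conjTranspose_eq, neg_add]
  · convert (sub_projU_inB X).add (sub_projU_inB Y) using 1
    abel

theorem projU_smul (c : ℝ) (X : Mat n n) : projU (c • X) = c • projU X := by
  ext i j
  rcases lt_trichotomy i j with h | h | h
  · simp [projU, h, h.not_gt]
  · subst h
    simp [projU, mul_assoc]
  · simp [projU, h]

theorem InB.projU_eq {X : Mat n n} (hX : InB X) : projU X = 0 :=
  (projU_eq_iff X 0).2 ⟨by simp [InU], by simpa using hX⟩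

theorem inB_of_projU_eq_zero {X : Mat n n} (h : projU X = 0) : InB X := by
  have := sub_projU_inB X
  rwa [h, sub_zero] at this

theorem projU_sub (X Y : Mat n n) : projU (X - Y) = projU X - projU Y := by
  have h := projU_add (X - Y) Y
  rw [sub_add_cancel] at h
  rw [h, add_sub_cancel_right]

/-- As `u(n)` and `b(n)` are isotropic, the adjoint of `projU` is `1 - projU`. -/
theorem imTr_mul_projU (A B : Mat n n) :
    imTr (A * projU B) = imTr (A * B) - imTr (projU A * B) := by
  have h1 := (projU_inU A).imTr_mul (projU_inU B)
  have h2 := (sub_projU_inB A).imTr_mul (sub_projU_inB B)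
  simp only [Matrix.mul_sub, Matrix.sub_mul, imTr_sub] at h2
  linarith

/-- The identity that makes `projU` a solution of the modified Yang-Baxter equation, in cyclic form.
It reflects that `u(n)` and `b(n)` are isotropic subalgebras. -/
theorem projU_cyclic (a b c : Mat n n) :
    (imTr (a * b * projU c) - imTr (a * c * projU b) - imTr (projU a * b * projU c)
        + imTr (projU a * c * projU b)) +
      (imTr (b * c * projU a) - imTr (b * a * projU c) - imTr (projU b * c * projU a)
        + imTr (projU b * a * projU c)) +
      (imTr (c * a * projU b) - imTr (c * b * projU a) - imTr (projU c * a * projU b)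
        + imTr (projU c * b * projU a)) =
    imTr (a * b * c) - imTr (a * c * b) := by
  have hu : imTr (projU a * projU b * projU c) - imTr (projU a * projU c * projU b) = 0 := by
    have h := imTr_conjTranspose (projU a * projU b * projU c)
    rw [Matrix.conjTranspose_mul, Matrix.conjTranspose_mul, (projU_inU a).conjTranspose_eq,
      (projU_inU b).conjTranspose_eq, (projU_inU c).conjTranspose_eq] at h
    simp only [neg_mul, mul_neg, neg_neg, imTr_neg] at h
    rw [← Matrix.mul_assoc, imTr_mul_rotate] at h
    linarith
  have hb1 := ((sub_projU_inB a).mul (sub_projU_inB b)).imTr_mul (sub_projU_inB c)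
  have hb2 := ((sub_projU_inB a).mul (sub_projU_inB c)).imTr_mul (sub_projU_inB b)
  simp only [Matrix.mul_sub, Matrix.sub_mul, imTr_sub] at hb1 hb2
  have r : ∀ A B C : Mat n n, imTr (A * B * C) = imTr (C * A * B) := imTr_mul_rotate
  rw [r b c (projU a), r (projU b) c (projU a), r c b (projU a), r (projU c) b (projU a),
    ← r a (projU c) b, ← r a (projU c) (projU b), ← r a (projU b) c, ← r a (projU b) (projU c)]
  linarith

/-- The variant of `projU_cyclic` for products taken in the opposite order. -/
theorem projU_cyclic' (a b c : Mat n n) :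
    (imTr (a * projU c * b) - imTr (a * projU b * c) - imTr (projU a * projU c * b)
        + imTr (projU a * projU b * c)) +
      (imTr (b * projU a * c) - imTr (b * projU c * a) - imTr (projU b * projU a * c)
        + imTr (projU b * projU c * a)) +
      (imTr (c * projU b * a) - imTr (c * projU a * b) - imTr (projU c * projU b * a)
        + imTr (projU c * projU a * b)) =
    imTr (a * c * b) - imTr (a * b * c) := by
  have h := projU_cyclic a b c
  have r : ∀ A B C : Mat n n, imTr (A * B * C) = imTr (C * A * B) := imTr_mul_rotate
  linarith [r a (projU c) b, r a (projU b) c, r b (projU a) c, r b (projU c) a,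
    r c (projU b) a, r c (projU a) b, r (projU c) b (projU a), r (projU b) c (projU a),
    r (projU a) c (projU b), r (projU c) a (projU b), r (projU b) a (projU c),
    r (projU a) b (projU c)]

end Pairing

/-! ### Smooth matrix calculus -/

section Calculus

variable {n d k : ℕ}

/-- Continuous real-linear maps between normed spaces. The abbreviation fixes the topology as the one
given by the norm; on matrices it is equal, but not syntactically, to the product topology that
instance search finds first. -/
abbrev NormedMap (E F : Type*) [NormedAddCommGroup E] [NormedSpace ℝ E] [NormedAddCommGroup F]
    [NormedSpace ℝ F] : Type _ := E →L[ℝ] F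

/-- The Fréchet derivative, with the same convention on topologies as `NormedMap`. -/
noncomputable abbrev normFDeriv {E F : Type*} [NormedAddCommGroup E] [NormedSpace ℝ E]
    [NormedAddCommGroup F] [NormedSpace ℝ F] (f : E → F) (x : E) : NormedMap E F := fderiv ℝ f x

section General

variable {E F G G' : Type*} [NormedAddCommGroup E] [NormedSpace ℝ E] [NormedAddCommGroup F]
  [NormedSpace ℝ F] [NormedAddCommGroup G] [NormedSpace ℝ G] [NormedAddCommGroup G']
  [NormedSpace ℝ G']

theorem normFDeriv_id (x w : E) : normFDeriv (fun y => y) x w = w := by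
  simp [normFDeriv]

theorem normFDeriv_const (c : F) (x w : E) : normFDeriv (fun _ : E => c) x w = 0 := by
  simp [normFDeriv]

theorem normFDeriv_add {f g : E → F} {x : E} (hf : ContDiffAt ℝ ∞ f x) (hg : ContDiffAt ℝ ∞ g x)
    (w : E) : normFDeriv (fun y => f y + g y) x w = normFDeriv f x w + normFDeriv g x w := by
  simp [normFDeriv, fderiv_fun_add (hf.differentiableAt (by simp)) (hg.differentiableAt (by simp))]

theorem normFDeriv_sub {f g : E → F} {x : E} (hf : ContDiffAt ℝ ∞ f x) (hg : ContDiffAt ℝ ∞ g x)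
    (w : E) : normFDeriv (fun y => f y - g y) x w = normFDeriv f x w - normFDeriv g x w := by
  simp [normFDeriv, fderiv_fun_sub (hf.differentiableAt (by simp)) (hg.differentiableAt (by simp))]

theorem normFDeriv_clm (L : F →L[ℝ] G) {f : E → F} {x : E} (hf : ContDiffAt ℝ ∞ f x) (w : E) :
    normFDeriv (fun y => L (f y)) x w = L (normFDeriv f x w) := by
  have h : HasFDerivAt (fun y => L (f y)) (L.comp (fderiv ℝ f x)) x :=
    L.hasFDerivAt.comp x (hf.differentiableAt (by simp)).hasFDerivAt
  rw [normFDeriv, h.fderiv]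
  rfl

theorem normFDeriv_bilinear (B : F →L[ℝ] G →L[ℝ] G') {f : E → F} {g : E → G} {x : E}
    (hf : ContDiffAt ℝ ∞ f x) (hg : ContDiffAt ℝ ∞ g x) (w : E) :
    normFDeriv (fun y => B (f y) (g y)) x w =
      B (f x) (normFDeriv g x w) + B (normFDeriv f x w) (g x) := by
  rw [normFDeriv, (B.hasFDerivAt_of_bilinear (hf.differentiableAt (by simp)).hasFDerivAt
    (hg.differentiableAt (by simp)).hasFDerivAt).fderiv]
  simp

end General

/-- Matrix multiplication as a continuous real-bilinear map. -/
noncomputable def mulL (n d k : ℕ) : NormedMap (Mat n d) (NormedMap (Mat d k) (Mat n k)) :=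
  LinearMap.toContinuousBilinearMap
    (LinearMap.mk₂ ℝ (fun (A : Mat n d) (B : Mat d k) => A * B) Matrix.add_mul
      (fun c A B => Matrix.smul_mul c A B) Matrix.mul_add (fun c A B => Matrix.mul_smul A c B))

/-- The conjugate transpose as a continuous real-linear map. -/
noncomputable def conjTransposeL (n d : ℕ) : NormedMap (Mat n d) (Mat d n) :=
  LinearMap.toContinuousLinearMap
    { toFun := fun A => Aᴴ
      map_add' := Matrix.conjTranspose_add
      map_smul' := fun c A => by simp [Matrix.conjTranspose_smul] }

/-- `projU` as a continuous real-linear map. -/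
noncomputable def projUL (n : ℕ) : NormedMap (Mat n n) (Mat n n) :=
  LinearMap.toContinuousLinearMap
    { toFun := projU
      map_add' := projU_add
      map_smul' := projU_smul }

variable {E : Type*} [NormedAddCommGroup E] [NormedSpace ℝ E]

theorem contDiffAt_mul {f : E → Mat n d} {g : E → Mat d k} {x : E} (hf : ContDiffAt ℝ ∞ f x)
    (hg : ContDiffAt ℝ ∞ g x) : ContDiffAt ℝ ∞ (fun y => f y * g y) x :=
  (mulL n d k).isBoundedBilinearMap.contDiff.contDiffAt.comp x (hf.prodMk hg)

theorem contDiffAt_conjTranspose {f : E → Mat n d} {x : E} (hf : ContDiffAt ℝ ∞ f x) :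
    ContDiffAt ℝ ∞ (fun y => (f y)ᴴ) x :=
  (conjTransposeL n d).contDiff.contDiffAt.comp x hf

theorem contDiffAt_projU {f : E → Mat n n} {x : E} (hf : ContDiffAt ℝ ∞ f x) :
    ContDiffAt ℝ ∞ (fun y => projU (f y)) x :=
  (projUL n).contDiff.contDiffAt.comp x hf

theorem normFDeriv_mul {f : E → Mat n d} {g : E → Mat d k} {x : E} (hf : ContDiffAt ℝ ∞ f x)
    (hg : ContDiffAt ℝ ∞ g x) (w : E) :
    normFDeriv (fun y => f y * g y) x w = f x * normFDeriv g x w + normFDeriv f x w * g x :=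
  normFDeriv_bilinear (mulL n d k) hf hg w

theorem normFDeriv_conjTranspose {f : E → Mat n d} {x : E} (hf : ContDiffAt ℝ ∞ f x) (w : E) :
    normFDeriv (fun y => (f y)ᴴ) x w = (normFDeriv f x w)ᴴ :=
  normFDeriv_clm (conjTransposeL n d) hf w

theorem normFDeriv_projU {f : E → Mat n n} {x : E} (hf : ContDiffAt ℝ ∞ f x) (w : E) :
    normFDeriv (fun y => projU (f y)) x w = projU (normFDeriv f x w) :=
  normFDeriv_clm (projUL n) hf w

/-- The matrix of a covector under the pairing `(x, w) ↦ Im tr (x w)`. -/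
noncomputable def covMat (n d : ℕ) : NormedMap (NormedMap (Mat n d) ℝ) (Mat d n) :=
  LinearMap.toContinuousLinearMap
    { toFun := fun f => Matrix.of fun j i =>
        (f (Matrix.single i j Complex.I) : ℂ) + (f (Matrix.single i j 1) : ℂ) * Complex.I
      map_add' := fun f g => by
        ext j i
        simp
        ring
      map_smul' := fun c f => by
        ext j i
        simp
        ring }

theorem diff_eq_covMat (F : Mat n d → ℝ) (v : Mat n d) :
    diff F v = covMat n d (normFDeriv F v) := rfl

theorem apply_eq_imTr (f : NormedMap (Mat n d) ℝ) (w : Mat n d) : f w = imTr (covMat n d f * w) := by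
  have h : normFDeriv f 0 w = imTr (covMat n d (normFDeriv f 0) * w) := fderiv_eq_im_trace f 0 w
  rwa [normFDeriv, ContinuousLinearMap.fderiv] at h

theorem covMat_eq_of_imTr {f : NormedMap (Mat n d) ℝ} {x : Mat d n} (h : ∀ w, f w = imTr (x * w)) :
    covMat n d f = x := by
  have key : ∀ (i : Fin n) (j : Fin d) (c : ℂ),
      imTr (x * Matrix.single i j c) = (x j i * c).im := by
    intro i j c
    rw [imTr, Matrix.trace_mul_single]
    simp
  ext j i
  apply Complex.ext
  · simp [covMat, h, key]
  · simp [covMat, h, key]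

end Calculus

/-! ### The Zakrzewski bivector is Poisson -/

section ZakAnchor

variable {n d : ℕ}

/-- The anchor of the Zakrzewski bivector: the Hamiltonian vector at `v` of the covector
`w ↦ Im tr (x w)`. -/
noncomputable def zakSharp (lam : ℝ) (v : Mat n d) (x : Mat d n) : Mat n d :=
  v * x * v - projU (v * x) * v - v * projU (x * v) + lam • xᴴ

theorem zakBivector_eq (lam : ℝ) (v : Mat n d) (x y : Mat d n) :
    zakBivector lam v x y = imTr (y * zakSharp lam v x) := by
  have e1 : imTr (y * (projU (v * x) * v)) = imTr (projU (v * x) * (v * y)) := by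
    rw [imTr_mul_comm, Matrix.mul_assoc]
  have e2 : imTr (y * (v * projU (x * v))) = imTr (projU (x * v) * (y * v)) := by
    rw [← Matrix.mul_assoc, imTr_mul_comm]
  have e3 : imTr (y * (v * x * v)) = imTr (v * x * (v * y)) := by
    rw [imTr_mul_comm, Matrix.mul_assoc (v * x)]
  have e4 : imTr (x * v * (y * v)) = imTr (v * x * (v * y)) := by
    rw [imTr_mul_comm (v * x), Matrix.mul_assoc x, imTr_mul_comm x]
    simp only [Matrix.mul_assoc]
  have e5 : imTr (y * xᴴ) = -imTr (x * yᴴ) := by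
    rw [← imTr_conjTranspose, Matrix.conjTranspose_mul, Matrix.conjTranspose_conjTranspose]
  change imTr (v * x * projU (v * y)) + imTr (x * v * projU (y * v)) - imTr (x * v * y * v)
    - lam * imTr (x * yᴴ) = _
  rw [zakSharp, imTr_mul_projU, imTr_mul_projU, Matrix.mul_assoc (x * v), Matrix.mul_add,
    Matrix.mul_sub, Matrix.mul_sub, imTr_add, imTr_sub, imTr_sub, Matrix.mul_smul, imTr_smul,
    e1, e2, e3, e4, e5]
  ring

theorem zakBivector_skew (lam : ℝ) (v : Mat n d) (x y : Mat d n) :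
    zakBivector lam v x y = -zakBivector lam v y x := by
  have e1 : imTr (v * x * (v * y)) = imTr (x * v * (y * v)) := by
    rw [Matrix.mul_assoc, imTr_mul_comm]
    simp only [Matrix.mul_assoc]
  have e2 : imTr (y * v * (x * v)) = imTr (x * v * (y * v)) := imTr_mul_comm _ _
  have e3 : imTr (y * xᴴ) = -imTr (x * yᴴ) := by
    rw [← imTr_conjTranspose, Matrix.conjTranspose_mul, Matrix.conjTranspose_conjTranspose]
  change imTr (v * x * projU (v * y)) + imTr (x * v * projU (y * v)) - imTr (x * v * y * v)
    - lam * imTr (x * yᴴ) = -(imTr (v * y * projU (v * x)) + imTr (y * v * projU (x * v))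
    - imTr (y * v * x * v) - lam * imTr (y * xᴴ))
  rw [imTr_mul_projU (v * x), imTr_mul_projU (x * v), Matrix.mul_assoc (x * v),
    Matrix.mul_assoc (y * v), e3, e2, e1, imTr_mul_comm (v * y), imTr_mul_comm (y * v)]
  ring

/-- The matrix of the covector `w ↦ ∂_w (π_v (y, z))`, with `π` the Zakrzewski bivector. It does not
depend on the parameter, which enters in a constant term. -/
noncomputable def zakGrad (v : Mat n d) (y z : Mat d n) : Mat d n :=
  y * projU (v * z) - z * projU (v * y) + projU (z * v) * y - projU (y * v) * z

theorem normFDeriv_zakSharp (lam : ℝ) (v w : Mat n d) (x : Mat d n) :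
    normFDeriv (fun u => zakSharp lam u x) v w =
      w * x * v + v * x * w - projU (w * x) * v - projU (v * x) * w
        - w * projU (x * v) - v * projU (x * w) := by
  have hid : ContDiffAt ℝ ∞ (fun u : Mat n d => u) v := contDiffAt_id
  have hx : ContDiffAt ℝ ∞ (fun _ : Mat n d => x) v := contDiffAt_const
  have hvx := contDiffAt_mul hid hx
  have hxv := contDiffAt_mul hx hid
  have h1 := contDiffAt_mul hvx hid
  have h2 := contDiffAt_mul (contDiffAt_projU hvx) hid
  have h3 := contDiffAt_mul hid (contDiffAt_projU hxv)
  have e1 := normFDeriv_mul hvx hid w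
  have e2 := normFDeriv_mul (contDiffAt_projU hvx) hid w
  have e3 := normFDeriv_mul hid (contDiffAt_projU hxv) w
  rw [normFDeriv_projU hvx, normFDeriv_mul hid hx, normFDeriv_id, normFDeriv_const] at e2
  rw [normFDeriv_projU hxv, normFDeriv_mul hx hid, normFDeriv_id, normFDeriv_const] at e3
  rw [normFDeriv_mul hid hx, normFDeriv_id, normFDeriv_const] at e1
  have e := normFDeriv_add ((h1.sub h2).sub h3)
    (contDiffAt_const (c := (lam • xᴴ : Mat n d))) w
  rw [normFDeriv_sub (h1.sub h2) h3, normFDeriv_sub h1 h2, normFDeriv_const, e1, e2, e3] at e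
  refine e.trans ?_
  simp only [Matrix.mul_zero, Matrix.zero_mul, zero_add, add_zero]
  abel

/-- The derivative of the anchor along `w`, paired with `z`, is `zakGrad` paired with `w`. -/
theorem imTr_mul_fderiv_zakSharp (lam : ℝ) (v w : Mat n d) (y z : Mat d n) :
    imTr (z * normFDeriv (fun u => zakSharp lam u y) v w) = imTr (zakGrad v y z * w) := by
  rw [normFDeriv_zakSharp, zakGrad]
  simp only [Matrix.mul_add, Matrix.mul_sub, Matrix.add_mul, Matrix.sub_mul, imTr_add, imTr_sub]
  have e1 : imTr (z * (w * y * v)) = imTr (v * z * (w * y)) := by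
    rw [imTr_mul_comm, Matrix.mul_assoc, imTr_mul_comm]
  have e2 : imTr (z * (v * y * w)) = imTr (z * v * (y * w)) := by simp only [Matrix.mul_assoc]
  have e3 : imTr (z * (projU (w * y) * v)) = imTr (v * z * projU (w * y)) := by
    rw [← Matrix.mul_assoc, imTr_mul_rotate]
  have e4 : imTr (z * (v * projU (y * w))) = imTr (z * v * projU (y * w)) := by
    rw [Matrix.mul_assoc]
  have e5 : imTr (projU (v * z) * (w * y)) = imTr (y * projU (v * z) * w) := by
    rw [← Matrix.mul_assoc, imTr_mul_rotate]
  have e6 : imTr (z * (projU (v * y) * w)) = imTr (z * projU (v * y) * w) := by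
    rw [Matrix.mul_assoc]
  have e7 : imTr (z * (w * projU (y * v))) = imTr (projU (y * v) * z * w) := by
    rw [← Matrix.mul_assoc, imTr_mul_rotate]
  have e8 : imTr (projU (z * v) * (y * w)) = imTr (projU (z * v) * y * w) := by
    rw [Matrix.mul_assoc]
  rw [e1, e2, e3, e4, e6, e7, imTr_mul_projU (v * z), imTr_mul_projU (z * v), e5, e8]
  ring

/-- One summand of the Jacobi identity, sorted into products of `n × n` matrices, products of `d × d`
matrices, terms that contain projections of both sizes, and terms with the parameter. -/
theorem zakGrad_mul_expand (lam : ℝ) (v : Mat n d) (x y z : Mat d n) :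
    imTr (zakGrad v y z * zakSharp lam v x) =
      (imTr (v * x * (v * y) * projU (v * z)) - imTr (v * x * (v * z) * projU (v * y))
        - imTr (projU (v * x) * (v * y) * projU (v * z))
        + imTr (projU (v * x) * (v * z) * projU (v * y))) +
      (imTr (x * v * projU (z * v) * (y * v)) - imTr (x * v * projU (y * v) * (z * v))
        - imTr (projU (x * v) * projU (z * v) * (y * v))
        + imTr (projU (x * v) * projU (y * v) * (z * v))) +
      (-imTr (v * projU (z * v) * y * projU (v * x)) + imTr (v * projU (y * v) * z * projU (v * x))
        - imTr (v * projU (x * v) * y * projU (v * z))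
        + imTr (v * projU (x * v) * z * projU (v * y))) +
      lam * (imTr ((xᴴ * y) * projU (v * z)) - imTr ((xᴴ * z) * projU (v * y))
        + imTr ((y * xᴴ) * projU (z * v)) - imTr ((z * xᴴ) * projU (y * v))) := by
  -- the four ways in which a term of `zakSharp` meets a term of `zakGrad`
  have nn : ∀ (B : Mat n n) (y : Mat d n) (C : Mat n n),
      imTr (B * v * (y * C)) = imTr (B * (v * y) * C) := by
    intro B y C; simp only [Matrix.mul_assoc]
  have nd' : ∀ (x : Mat d n) (y : Mat d n) (C : Mat d d),
      imTr (v * C * y * (v * x)) = imTr (x * v * C * (y * v)) := by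
    intro x y C
    rw [← Matrix.mul_assoc, imTr_mul_comm]; simp only [Matrix.mul_assoc]
  have nd : ∀ (B : Mat n n) (y : Mat d n) (C : Mat d d),
      imTr (B * v * (C * y)) = imTr (v * C * y * B) := by
    intro B y C
    rw [Matrix.mul_assoc B, imTr_mul_comm B]; simp only [Matrix.mul_assoc]
  have dn : ∀ (B : Mat d d) (y : Mat d n) (C : Mat n n),
      imTr (v * B * (y * C)) = imTr (v * B * y * C) := by
    intro B y C; simp only [Matrix.mul_assoc]
  have dd : ∀ (B : Mat d d) (y : Mat d n) (C : Mat d d),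
      imTr (v * B * (C * y)) = imTr (B * C * (y * v)) := by
    intro B y C
    rw [Matrix.mul_assoc v, imTr_mul_comm v]; simp only [Matrix.mul_assoc]
  have l1 : ∀ (y : Mat d n) (C : Mat n n), imTr (xᴴ * (y * C)) = imTr (xᴴ * y * C) := by
    intro y C; rw [Matrix.mul_assoc]
  have l2 : ∀ (y : Mat d n) (C : Mat d d), imTr (xᴴ * (C * y)) = imTr (y * xᴴ * C) := by
    intro y C; rw [← Matrix.mul_assoc, imTr_mul_rotate]
  rw [imTr_mul_comm, zakSharp, zakGrad]
  simp only [Matrix.mul_add, Matrix.mul_sub, Matrix.add_mul, Matrix.sub_mul, imTr_add, imTr_sub,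
    Matrix.smul_mul, imTr_smul, nn, nd, nd', dn, dd, l1, l2]
  ring

/-- The Jacobi identity for constant covectors. The terms with projections of both sizes cancel in
the cyclic sum, and the products of square matrices of either size are evaluated by `projU_cyclic` and
`projU_cyclic'`, with opposite results. -/
theorem zakGrad_cyclic (lam : ℝ) (v : Mat n d) (x y z : Mat d n) :
    imTr (zakGrad v y z * zakSharp lam v x) + imTr (zakGrad v z x * zakSharp lam v y) +
      imTr (zakGrad v x y * zakSharp lam v z) = 0 := by
  have hn := projU_cyclic (v * x) (v * y) (v * z)
  have hd := projU_cyclic' (x * v) (y * v) (z * v)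
  have t : ∀ x y z : Mat d n, imTr (x * v * (y * v) * (z * v)) = imTr (v * x * (v * y) * (v * z)) := by
    intro x y z
    rw [← Matrix.mul_assoc, imTr_mul_comm]
    simp only [Matrix.mul_assoc]
  rw [t, t] at hd
  -- the parameter is paired with the skew-Hermitian matrices `x†y - y†x` and `yx† - xy†`
  have ln : ∀ x y z : Mat d n,
      imTr (xᴴ * y * projU (v * z)) = imTr (yᴴ * x * projU (v * z)) := by
    intro x y z
    have h : InU (xᴴ * y - yᴴ * x) := by
      have := inU_sub_conjTranspose (xᴴ * y)
      rwa [Matrix.conjTranspose_mul, Matrix.conjTranspose_conjTranspose] at this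
    have h' := h.imTr_mul (projU_inU (v * z))
    rw [Matrix.sub_mul, imTr_sub] at h'
    linarith
  have ld : ∀ x y z : Mat d n,
      imTr (y * xᴴ * projU (z * v)) = imTr (x * yᴴ * projU (z * v)) := by
    intro x y z
    have h : InU (y * xᴴ - x * yᴴ) := by
      have := inU_sub_conjTranspose (y * xᴴ)
      rwa [Matrix.conjTranspose_mul, Matrix.conjTranspose_conjTranspose] at this
    have h' := h.imTr_mul (projU_inU (z * v))
    rw [Matrix.sub_mul, imTr_sub] at h'
    linarith
  rw [zakGrad_mul_expand, zakGrad_mul_expand, zakGrad_mul_expand, ln x y z, ln x z y, ln y z x,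
    ld x y z, ld x z y, ld y z x]
  linarith

theorem zakSharp_poissonAnchor (n d : ℕ) (lam : ℝ) :
    PoissonAnchor fun (v : Mat n d) (f : NormedMap (Mat n d) ℝ) => zakSharp lam v (covMat n d f) := by
  refine ⟨?_, ?_, ?_, ?_, ?_⟩
  · rw [contDiff_iff_contDiffAt]
    intro p
    have hv : ContDiffAt ℝ ∞ (fun p : Mat n d × NormedMap (Mat n d) ℝ => p.1) p := contDiffAt_fst
    have hx : ContDiffAt ℝ ∞ (fun p : Mat n d × NormedMap (Mat n d) ℝ => covMat n d p.2) p :=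
      (covMat n d).contDiff.contDiffAt.comp p contDiffAt_snd
    have h1 := contDiffAt_mul hv hx
    exact (((contDiffAt_mul h1 hv).sub (contDiffAt_mul (contDiffAt_projU h1) hv)).sub
      (contDiffAt_mul hv (contDiffAt_projU (contDiffAt_mul hx hv)))).add
      ((contDiffAt_conjTranspose hx).const_smul lam)
  · intro v f g
    simp only [zakSharp, map_add, Matrix.mul_add, Matrix.add_mul, projU_add,
      Matrix.conjTranspose_add, smul_add]
    abel
  · intro v c f
    simp only [zakSharp, map_smul, Matrix.mul_smul, Matrix.smul_mul, projU_smul,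
      Matrix.conjTranspose_smul, star_trivial, smul_sub, smul_add, smul_comm lam c]
  · intro v f g
    rw [apply_eq_imTr, apply_eq_imTr, ← zakBivector_eq, ← zakBivector_eq, zakBivector_skew]
  · intro v f g h
    have e : ∀ (f g h : NormedMap (Mat n d) ℝ),
        h (normFDeriv (fun u => zakSharp lam u (covMat n d g)) v (zakSharp lam v (covMat n d f))) =
          imTr (zakGrad v (covMat n d g) (covMat n d h) * zakSharp lam v (covMat n d f)) := by
      intro f g h
      rw [apply_eq_imTr h, imTr_mul_fderiv_zakSharp]
    change h (normFDeriv _ v _) + f (normFDeriv _ v _) + g (normFDeriv _ v _) = 0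
    rw [e f g h, e g h f, e h f g]
    exact zakGrad_cyclic lam v _ _ _

theorem zakBracket_eq (lam : ℝ) (F H : Mat n d → ℝ) (v : Mat n d) :
    zakBracket n d lam F H v =
      normFDeriv H v (zakSharp lam v (covMat n d (normFDeriv F v))) := by
  rw [zakBracket, zakBivector_eq, diff_eq_covMat, diff_eq_covMat,
    ← apply_eq_imTr (normFDeriv H v)]

theorem zakBracket_isPoissonBracketOn (lam : ℝ) {U : Set (Mat n d)} (hU : IsOpen U) :
    IsPoissonBracketOn U (zakBracket n d lam) :=
  (zakSharp_poissonAnchor n d lam).isPoissonBracketOn hU fun F H _ _ x _ => zakBracket_eq lam F H x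

end ZakAnchor

/-! ### The Cholesky factorization with upper triangular factor -/

section Borel

variable {n d : ℕ}

theorem inB_of_mem_borelGroup {b : Mat n n} (hb : b ∈ BorelGroup n) : InB b :=
  ⟨hb.1, fun i => (hb.2 i).1⟩

theorem diag_ne_zero_of_mem_borelGroup {b : Mat n n} (hb : b ∈ BorelGroup n) (i : Fin n) :
    b i i ≠ 0 := fun h => by
  have := (hb.2 i).2
  rw [h] at this
  simp at this

theorem isUnit_det_of_mem_borelGroup {b : Mat n n} (hb : b ∈ BorelGroup n) : IsUnit b.det := by
  have h : b.BlockTriangular id := fun i j hij => hb.1 i j hij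
  rw [Matrix.det_of_isUpperTriangular h, isUnit_iff_ne_zero]
  exact Finset.prod_ne_zero_iff.2 fun i _ => diag_ne_zero_of_mem_borelGroup hb i

theorem mul_mem_borelGroup {a b : Mat n n} (ha : a ∈ BorelGroup n) (hb : b ∈ BorelGroup n) :
    a * b ∈ BorelGroup n := by
  refine ⟨mul_upper ha.1 hb.1, fun i => ?_⟩
  rw [mul_diag_of_upper ha.1 hb.1, Complex.mul_im, Complex.mul_re, (ha.2 i).1, (hb.2 i).1]
  have := mul_pos (ha.2 i).2 (hb.2 i).2
  simpa using this

theorem inv_upper {b : Mat n n} (hu : IsUnit b.det) (hb : ∀ i j, j < i → b i j = 0) :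
    ∀ i j, j < i → b⁻¹ i j = 0 := by
  have h : b.BlockTriangular id := fun i j hij => hb i j hij
  have : Invertible b := b.invertibleOfIsUnitDet hu
  have h' := Matrix.blockTriangular_inv_of_blockTriangular h
  exact fun i j hij => h' hij

theorem inv_mem_borelGroup {b : Mat n n} (hb : b ∈ BorelGroup n) : b⁻¹ ∈ BorelGroup n := by
  have hu := isUnit_det_of_mem_borelGroup hb
  have hup := inv_upper hu hb.1
  refine ⟨hup, fun i => ?_⟩
  have h := mul_diag_of_upper hb.1 hup i
  rw [Matrix.mul_nonsing_inv b hu, Matrix.one_apply_eq] at h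
  obtain ⟨h1, h2⟩ := hb.2 i
  have hre := congrArg Complex.re h
  have him := congrArg Complex.im h
  rw [Complex.mul_re, h1, zero_mul, sub_zero, Complex.one_re] at hre
  rw [Complex.mul_im, h1, zero_mul, add_zero, Complex.one_im] at him
  refine ⟨(mul_eq_zero.1 him.symm).resolve_left h2.ne', ?_⟩
  exact pos_of_mul_pos_right (hre ▸ one_pos) h2.le

theorem InB.conj_borel {b β : Mat n n} (hβ : InB β) (hb : b ∈ BorelGroup n) :
    InB (b * β * b⁻¹) :=
  ((inB_of_mem_borelGroup hb).mul hβ).mul (inB_of_mem_borelGroup (inv_mem_borelGroup hb))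

theorem eq_of_mul_conjTranspose_eq {b c : Mat n n} (hb : b ∈ BorelGroup n)
    (hc : c ∈ BorelGroup n) (h : b * bᴴ = c * cᴴ) : b = c := by
  have hcu := isUnit_det_of_mem_borelGroup hc
  have hu : c⁻¹ * b ∈ BorelGroup n := mul_mem_borelGroup (inv_mem_borelGroup hc) hb
  have h1 : (c⁻¹ * b) * (c⁻¹ * b)ᴴ = 1 := by
    rw [Matrix.conjTranspose_mul, Matrix.mul_assoc, ← Matrix.mul_assoc b, h, Matrix.mul_assoc c,
      ← Matrix.conjTranspose_mul, Matrix.nonsing_inv_mul c hcu, Matrix.conjTranspose_one,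
      Matrix.mul_one, Matrix.nonsing_inv_mul c hcu]
  set u := c⁻¹ * b
  have huu := isUnit_det_of_mem_borelGroup hu
  have hinv : uᴴ = u⁻¹ := (Matrix.inv_eq_right_inv h1).symm
  have hone : u = 1 := by
    ext i j
    rcases lt_trichotomy i j with hij | hij | hij
    · have := inv_upper huu hu.1 j i hij
      rw [← hinv, Matrix.conjTranspose_apply, star_eq_zero] at this
      rw [this, Matrix.one_apply_ne hij.ne]
    · subst hij
      have h2 := mul_diag_of_upper hu.1 (inv_upper huu hu.1) i
      rw [← hinv, h1, Matrix.one_apply_eq, Matrix.conjTranspose_apply] at h2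
      obtain ⟨h3, h4⟩ := hu.2 i
      have h5 := congrArg Complex.re h2
      simp [h3] at h5
      rw [Matrix.one_apply_eq]
      apply Complex.ext
      · simp only [Complex.one_re]
        nlinarith
      · simpa using h3
    · rw [hu.1 i j hij, Matrix.one_apply_ne hij.ne']
  rw [← Matrix.mul_one c, ← hone, Matrix.mul_nonsing_inv_cancel_left c _ hcu]

/-- The Cholesky factorization, over any finite linear order: rescale the lower triangular factor of
the LDL decomposition by the square roots of the diagonal and by phases. -/
theorem exists_lower_mul_conjTranspose {ι : Type*} [Fintype ι] [LinearOrder ι] [WellFoundedLT ι]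
    [LocallyFiniteOrderBot ι] {M : Matrix ι ι ℂ} (hM : M.PosDef) :
    ∃ C : Matrix ι ι ℂ, (∀ i j, i < j → C i j = 0) ∧ (∀ i, (C i i).im = 0 ∧ 0 < (C i i).re) ∧
      C * Cᴴ = M := by
  have hlow : ∀ i j, i < j → LDL.lower hM i j = 0 := by
    have h : (LDL.lowerInv hM).BlockTriangular OrderDual.toDual :=
      fun i j hij => LDL.lowerInv_triangular hM hij
    have h' := Matrix.blockTriangular_inv_of_blockTriangular h
    exact fun i j hij => h' (i := i) (j := j) hij
  have hunit : IsUnit (LDL.lowerInv hM).det :=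
    (Matrix.isUnit_iff_isUnit_det _).1 (isUnit_of_invertible _)
  have hne : ∀ i, LDL.lower hM i i ≠ 0 := by
    have hdet : (LDL.lower hM).det ≠ 0 := by
      rw [LDL.lower]
      exact ((Matrix.isUnit_nonsing_inv_det _) hunit).ne_zero
    rw [Matrix.det_of_isLowerTriangular _ fun i j hij => hlow i j hij] at hdet
    exact fun i => Finset.prod_ne_zero_iff.1 hdet i (Finset.mem_univ i)
  have hD : ∀ i, 0 < LDL.diagEntries hM i := by
    have h : (LDL.diag hM).PosDef := by
      rw [LDL.diag_eq_lowerInv_conj]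
      exact (Matrix.IsUnit.posDef_star_right_conjugate_iff
        ((Matrix.isUnit_iff_isUnit_det _).2 hunit)).2 hM
    rw [LDL.diag, Matrix.posDef_diagonal_iff] at h
    exact h
  set L := LDL.lower hM
  set D := LDL.diagEntries hM
  let s : ι → ℂ := fun i => star (L i i) / (‖L i i‖ : ℂ) * (Real.sqrt (D i).re : ℂ)
  have hn : ∀ i, (‖L i i‖ : ℂ) ≠ 0 := fun i => by
    exact_mod_cast norm_ne_zero_iff.2 (hne i)
  have hnorm : ∀ i, L i i * star (L i i) = (‖L i i‖ : ℂ) * (‖L i i‖ : ℂ) := fun i => by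
    rw [Complex.star_def, Complex.mul_conj, Complex.normSq_eq_norm_sq]
    push_cast
    ring
  have hs : ∀ i, s i * star (s i) = D i := by
    intro i
    have h1 : ((Real.sqrt (D i).re : ℂ)) * (Real.sqrt (D i).re : ℂ) = D i := by
      have h := Complex.pos_iff.1 (hD i)
      rw [← Complex.ofReal_mul, Real.mul_self_sqrt h.1.le]
      apply Complex.ext <;> simp [h.2]
    have h2 : star (s i) = L i i / (‖L i i‖ : ℂ) * (Real.sqrt (D i).re : ℂ) := by
      simp [s]
    have h3 : s i * star (s i) = (L i i * star (L i i)) / ((‖L i i‖ : ℂ) * (‖L i i‖ : ℂ)) *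
        ((Real.sqrt (D i).re : ℂ) * (Real.sqrt (D i).re : ℂ)) := by
      rw [h2]
      simp only [s]
      ring
    rw [h3, hnorm, h1, div_self (mul_ne_zero (hn i) (hn i)), one_mul]
  have hdiag : ∀ i, L i i * s i = ((‖L i i‖ * Real.sqrt (D i).re : ℝ) : ℂ) := by
    intro i
    simp only [s]
    have := hn i
    push_cast
    field_simp
    linear_combination (Real.sqrt (D i).re : ℂ) * hnorm i
  refine ⟨L * Matrix.diagonal s, fun i j hij => ?_, fun i => ?_, ?_⟩
  · rw [Matrix.mul_diagonal, hlow i j hij, zero_mul]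
  · rw [Matrix.mul_diagonal, hdiag]
    refine ⟨Complex.ofReal_im _, ?_⟩
    rw [Complex.ofReal_re]
    exact mul_pos (norm_pos_iff.2 (hne i)) (Real.sqrt_pos.2 (Complex.pos_iff.1 (hD i)).1)
  · rw [Matrix.conjTranspose_mul, Matrix.diagonal_conjTranspose, Matrix.mul_assoc,
      ← Matrix.mul_assoc (Matrix.diagonal s), Matrix.diagonal_mul_diagonal, ← Matrix.mul_assoc]
    have h : (fun i => s i * star s i) = D := funext hs
    rw [h]
    exact LDL.lower_conj_diag hM

/-- The lower triangular factorization for the reversed order is the upper triangular one. -/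
theorem exists_borel_mul_conjTranspose {M : Mat n n} (hM : M.PosDef) :
    ∃ b ∈ BorelGroup n, b * bᴴ = M := by
  obtain ⟨C, h1, h2, h3⟩ := exists_lower_mul_conjTranspose
    (hM.submatrix (e := (OrderDual.ofDual : (Fin n)ᵒᵈ → Fin n)) OrderDual.ofDual.injective)
  refine ⟨C.submatrix OrderDual.toDual OrderDual.toDual, ⟨fun i j hij => h1 _ _ hij,
    fun i => h2 _⟩, ?_⟩
  rw [Matrix.conjTranspose_submatrix, Matrix.submatrix_mul_equiv, h3]
  rfl

theorem posDef_of_borel {b : Mat n n} (hb : b ∈ BorelGroup n) : (b * bᴴ).PosDef := by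
  have hu := (Matrix.isUnit_iff_isUnit_det _).2 (isUnit_det_of_mem_borelGroup hb)
  have := (Matrix.IsUnit.posDef_star_right_conjugate_iff hu).2
    (Matrix.PosDef.one (n := Fin n) (R := ℂ))
  rwa [Matrix.mul_one] at this

theorem bOf_spec {lam : ℝ} {v : Mat n d} (hv : v ∈ posDomain n d lam) :
    bOf lam v ∈ BorelGroup n ∧ bOf lam v * (bOf lam v)ᴴ = momentum lam v := by
  have h := exists_borel_mul_conjTranspose (M := momentum lam v) hv
  rw [bOf, dif_pos h]
  exact h.choose_spec

theorem mem_posDomain_of_borel {lam : ℝ} {v : Mat n d} {b : Mat n n} (hb : b ∈ BorelGroup n)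
    (h : b * bᴴ = momentum lam v) : v ∈ posDomain n d lam ∧ bOf lam v = b := by
  have hv : v ∈ posDomain n d lam := by
    change (momentum lam v).PosDef
    rw [← h]
    exact posDef_of_borel hb
  exact ⟨hv, eq_of_mul_conjTranspose_eq (bOf_spec hv).1 hb ((bOf_spec hv).2.trans h.symm)⟩

theorem posDomain_eq_univ {lam : ℝ} (h : 0 < lam) : posDomain n d lam = Set.univ := by
  refine Set.eq_univ_of_forall fun v => ?_
  change (momentum lam v).PosDef
  refine Matrix.PosDef.add_posSemidef ?_ (Matrix.posSemidef_self_mul_conjTranspose v)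
  refine Matrix.PosDef.smul Matrix.PosDef.one ?_
  exact_mod_cast h

end Borel

/-! ### Smoothness of the Cholesky factor -/

section Smooth

/-- The inverse function theorem for a smooth self-map of a finite-dimensional space. -/
theorem exists_contDiffAt_rightInverse {E : Type*} [NormedAddCommGroup E] [NormedSpace ℝ E]
    [FiniteDimensional ℝ E] {f : E → E} {a : E} (hf : ContDiffAt ℝ ∞ f a)
    (hinj : ∀ w, normFDeriv f a w = 0 → w = 0) :
    ∃ g : E → E, ContDiffAt ℝ ∞ g (f a) ∧ g (f a) = a ∧ ∀ᶠ y in nhds (f a), f (g y) = y := by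
  have : CompleteSpace E := FiniteDimensional.complete ℝ E
  let e : E ≃L[ℝ] E := (LinearEquiv.ofInjectiveEndo (fderiv ℝ f a).toLinearMap
    ((injective_iff_map_eq_zero _).2 hinj)).toContinuousLinearEquiv
  have he : (e : E →L[ℝ] E) = fderiv ℝ f a := by
    ext w
    rfl
  have hf' : HasFDerivAt f (e : E →L[ℝ] E) a := by
    rw [he]
    exact (hf.differentiableAt (by simp)).hasFDerivAt
  have hn : (∞ : WithTop ℕ∞) ≠ 0 := by simp
  refine ⟨hf.localInverse hf' hn, hf.to_localInverse hf' hn, hf.localInverse_apply_image hf' hn, ?_⟩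
  exact (hf.hasStrictFDerivAt' hf' hn).eventually_right_inverse

variable {n d : ℕ}

theorem contDiffAt_momentum (lam : ℝ) (v : Mat n d) :
    ContDiffAt ℝ ∞ (fun u : Mat n d => momentum lam u) v :=
  contDiffAt_const.add (contDiffAt_mul contDiffAt_id (contDiffAt_conjTranspose contDiffAt_id))

theorem conjTranspose_momentum (lam : ℝ) (v : Mat n d) : (momentum lam v)ᴴ = momentum lam v := by
  simp [momentum, Matrix.conjTranspose_smul]

theorem normFDeriv_momentum (lam : ℝ) (v w : Mat n d) :
    normFDeriv (fun u : Mat n d => momentum lam u) v w = v * wᴴ + w * vᴴ := by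
  have hid : ContDiffAt ℝ ∞ (fun u : Mat n d => u) v := contDiffAt_id
  have e1 := normFDeriv_mul hid (contDiffAt_conjTranspose hid) w
  rw [normFDeriv_conjTranspose hid, normFDeriv_id] at e1
  have e := normFDeriv_add (contDiffAt_const (c := ((lam : ℂ) • (1 : Mat n n))))
    (contDiffAt_mul hid (contDiffAt_conjTranspose hid)) w
  rw [normFDeriv_const, zero_add, e1] at e
  exact e

theorem eq_zero_of_inU_of_inB {X : Mat n n} (hu : InU X) (hb : InB X) : X = 0 := by
  rw [← hu.projU_eq, hb.projU_eq]

theorem conjTranspose_nonsing_inv_mul {b : Mat n n} (hb : IsUnit b.det) : bᴴ * b⁻¹ᴴ = 1 := by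
  rw [← Matrix.conjTranspose_mul, Matrix.nonsing_inv_mul b hb, Matrix.conjTranspose_one]

/-- Near a point of `posDomain` the Cholesky factor is the composite of `momentum` with a local
inverse of `X ↦ X X† + projU X`. The value of this map determines both `X X†` and `projU X`, as its
Hermitian and its skew-Hermitian part; where it is Hermitian, `X` is upper triangular. -/
theorem eventually_bOf {lam : ℝ} {v : Mat n d} (hv : v ∈ posDomain n d lam) :
    (∀ᶠ u in nhds v, u ∈ posDomain n d lam) ∧ ContDiffAt ℝ ∞ (fun u : Mat n d => bOf lam u) v := by
  obtain ⟨hb, hbm⟩ := bOf_spec hv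
  set b := bOf lam v
  have hbu := isUnit_det_of_mem_borelGroup hb
  have hid : ContDiffAt ℝ ∞ (fun X : Mat n n => X) b := contDiffAt_id
  have h1 := contDiffAt_mul hid (contDiffAt_conjTranspose hid)
  have hf : ContDiffAt ℝ ∞ (fun X : Mat n n => X * Xᴴ + projU X) b := h1.add (contDiffAt_projU hid)
  have hskew : ∀ {H K : Mat n n}, Hᴴ = H → InU K → (H + K)ᴴ = H + K → K = 0 := by
    intro H K hH hK h
    rw [Matrix.conjTranspose_add, hH, hK.conjTranspose_eq] at h
    have h' : -K = K := add_left_cancel h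
    ext i j
    exact neg_eq_self.1 (congrFun (congrFun h' i) j)
  have hherm : ∀ X : Mat n n, (X * Xᴴ)ᴴ = X * Xᴴ := fun X => by
    rw [Matrix.conjTranspose_mul, Matrix.conjTranspose_conjTranspose]
  have hinj : ∀ W, normFDeriv (fun X : Mat n n => X * Xᴴ + projU X) b W = 0 → W = 0 := by
    intro W hW
    have e := normFDeriv_add h1 (contDiffAt_projU hid) W
    rw [normFDeriv_mul hid (contDiffAt_conjTranspose hid), normFDeriv_conjTranspose hid,
      normFDeriv_projU hid, normFDeriv_id] at e
    have e0 : b * Wᴴ + W * bᴴ + projU W = 0 := e.symm.trans hW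
    have hP : projU W = 0 := by
      refine hskew (H := b * Wᴴ + W * bᴴ) ?_ (projU_inU W) ?_
      · simp [Matrix.conjTranspose_add, Matrix.conjTranspose_mul, add_comm]
      · rw [e0, Matrix.conjTranspose_zero]
    rw [hP, add_zero] at e0
    have hB : InB (b⁻¹ * W) :=
      (inB_of_mem_borelGroup (inv_mem_borelGroup hb)).mul (inB_of_projU_eq_zero hP)
    have hU : InU (b⁻¹ * W) := by
      have e2 : b⁻¹ * (b * Wᴴ + W * bᴴ) * b⁻¹ᴴ = 0 := by rw [e0]; simp
      rw [Matrix.mul_add, Matrix.nonsing_inv_mul_cancel_left b _ hbu, Matrix.add_mul,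
        ← Matrix.mul_assoc, Matrix.mul_assoc _ bᴴ, conjTranspose_nonsing_inv_mul hbu,
        Matrix.mul_one, ← Matrix.conjTranspose_mul] at e2
      rw [InU, add_comm]
      exact e2
    rw [← Matrix.mul_nonsing_inv_cancel_left b W hbu, eq_zero_of_inU_of_inB hU hB, Matrix.mul_zero]
  obtain ⟨g, hg, hga, hgr⟩ := exists_contDiffAt_rightInverse hf hinj
  have hfb : b * bᴴ + projU b = momentum lam v := by
    rw [(inB_of_mem_borelGroup hb).projU_eq, add_zero, hbm]
  simp only [hfb] at hg hga hgr
  have hm := contDiffAt_momentum lam v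
  have hgm : ContDiffAt ℝ ∞ (fun u : Mat n d => g (momentum lam u)) v := hg.comp v hm
  have hpos : ∀ᶠ u in nhds v, ∀ i, 0 < (g (momentum lam u) i i).re := by
    rw [Filter.eventually_all]
    intro i
    have hc : ContinuousAt (fun u : Mat n d => (g (momentum lam u) i i).re) v := by
      have h2 : Continuous fun X : Mat n n => (X i i).re :=
        Complex.continuous_re.comp (continuous_id.matrix_elem i i)
      exact h2.continuousAt.comp (f := fun u : Mat n d => g (momentum lam u)) hgm.continuousAt
    refine hc.eventually (lt_mem_nhds ?_)
    change 0 < (g (momentum lam v) i i).re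
    rw [hga]
    exact (hb.2 i).2
  have hev : ∀ᶠ u in nhds v, u ∈ posDomain n d lam ∧ bOf lam u = g (momentum lam u) := by
    filter_upwards [hpos, hm.continuousAt.eventually hgr] with u hu1 hu2
    have hP : projU (g (momentum lam u)) = 0 :=
      hskew (hherm _) (projU_inU _) (by rw [hu2, conjTranspose_momentum])
    rw [hP, add_zero] at hu2
    have hB := inB_of_projU_eq_zero hP
    exact mem_posDomain_of_borel ⟨hB.1, fun i => ⟨hB.2 i, hu1 i⟩⟩ hu2
  exact ⟨hev.mono fun u hu => hu.1, hgm.congr_of_eventuallyEq (hev.mono fun u hu => hu.2)⟩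

theorem isOpen_posDomain (n d : ℕ) (lam : ℝ) : IsOpen (posDomain n d lam) :=
  isOpen_iff_eventually.2 fun _ hv => (eventually_bOf hv).1

theorem contDiffAt_bOf {lam : ℝ} {v : Mat n d} (hv : v ∈ posDomain n d lam) :
    ContDiffAt ℝ ∞ (fun u : Mat n d => bOf lam u) v :=
  (eventually_bOf hv).2

/-- The derivative `β` of the Cholesky factor `b` lies in `b(n)`, and it satisfies the equation
obtained by differentiating `b b† = λ + v v†`. -/
theorem normFDeriv_bOf {lam : ℝ} {v : Mat n d} (hv : v ∈ posDomain n d lam) (w : Mat n d) :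
    InB (normFDeriv (fun u : Mat n d => bOf lam u) v w) ∧
      bOf lam v * (normFDeriv (fun u : Mat n d => bOf lam u) v w)ᴴ +
        normFDeriv (fun u : Mat n d => bOf lam u) v w * (bOf lam v)ᴴ = v * wᴴ + w * vᴴ := by
  have hb := contDiffAt_bOf hv
  have hev := (isOpen_posDomain n d lam).mem_nhds hv
  constructor
  · apply inB_of_projU_eq_zero
    rw [← normFDeriv_projU hb, ← normFDeriv_const (E := Mat n d) (0 : Mat n n) v w, normFDeriv,
      normFDeriv, Filter.EventuallyEq.fderiv_eq]
    filter_upwards [hev] with u hu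
    exact (inB_of_mem_borelGroup (bOf_spec hu).1).projU_eq
  · rw [← normFDeriv_conjTranspose hb, ← normFDeriv_mul hb (contDiffAt_conjTranspose hb),
      ← normFDeriv_momentum lam, normFDeriv, normFDeriv, Filter.EventuallyEq.fderiv_eq]
    filter_upwards [hev] with u hu
    exact (bOf_spec hu).2

/-- The inverse of a smooth family of continuous linear maps is smooth. -/
theorem contDiffAt_clm_inverse {E F : Type*} [NormedAddCommGroup E] [NormedSpace ℝ E]
    [NormedAddCommGroup F] [NormedSpace ℝ F] [CompleteSpace F] {A B : E → F →L[ℝ] F} {x : E}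
    (hA : ContDiffAt ℝ ∞ A x)
    (h : ∀ᶠ y in nhds x, (∀ w, B y (A y w) = w) ∧ ∀ w, A y (B y w) = w) :
    ContDiffAt ℝ ∞ B x := by
  have h1 : ContDiffAt ℝ ∞ (fun y => ContinuousLinearMap.inverse (A y)) x := by
    obtain ⟨h2, h3⟩ := h.self_of_nhds
    have h4 := contDiffAt_map_inverse (n := ∞)
      (ContinuousLinearEquiv.equivOfInverse (A x) (B x) h2 h3)
    exact h4.comp x hA
  refine h1.congr_of_eventuallyEq ?_
  filter_upwards [h] with y hy
  exact (ContinuousLinearMap.inverse_equiv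
    (ContinuousLinearEquiv.equivOfInverse (A y) (B y) hy.1 hy.2)).symm

theorem contDiffAt_inv_mul {E : Type*} [NormedAddCommGroup E] [NormedSpace ℝ E]
    {f : E → Mat n n} {g : E → Mat n d} {x : E} (hf : ContDiffAt ℝ ∞ f x)
    (hg : ContDiffAt ℝ ∞ g x) (hu : ∀ᶠ y in nhds x, IsUnit (f y).det) :
    ContDiffAt ℝ ∞ (fun y => (f y)⁻¹ * g y) x := by
  have : CompleteSpace (Mat n d) := FiniteDimensional.complete ℝ (Mat n d)
  have h : ContDiffAt ℝ ∞ (fun y => mulL n n d (f y)⁻¹) x := by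
    refine contDiffAt_clm_inverse ((mulL n n d).contDiff.contDiffAt.comp x hf) ?_
    filter_upwards [hu] with y hy
    exact ⟨fun V => Matrix.nonsing_inv_mul_cancel_left (f y) V hy,
      fun V => Matrix.mul_nonsing_inv_cancel_left (f y) V hy⟩
  exact h.clm_apply hg

end Smooth

/-! ### Block decomposition of the Zakrzewski bivector -/

section Blocks

variable {n d₁ d₂ : ℕ}

/-- The last `d₂` columns. -/
def rightBlock (W : Mat n (d₁ + d₂)) : Mat n d₂ :=
  Matrix.of fun i j => W i (Fin.natAdd d₁ j)

/-- The first `d₁` rows. -/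
def topBlock (x : Mat (d₁ + d₂) n) : Mat d₁ n := Matrix.of fun i j => x (Fin.castAdd d₂ i) j

/-- The last `d₂` rows. -/
def botBlock (x : Mat (d₁ + d₂) n) : Mat d₂ n := Matrix.of fun i j => x (Fin.natAdd d₁ i) j

@[simp] theorem leftBlock_concat (v : Mat n d₁) (V : Mat n d₂) : leftBlock (concat v V) = v := by
  ext i j
  simp [leftBlock, concat]

@[simp] theorem rightBlock_concat (v : Mat n d₁) (V : Mat n d₂) : rightBlock (concat v V) = V := by
  ext i j
  simp [rightBlock, concat]

@[simp] theorem concat_blocks (W : Mat n (d₁ + d₂)) : concat (leftBlock W) (rightBlock W) = W := by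
  ext i j
  refine Fin.addCases (fun j => ?_) (fun j => ?_) j <;> simp [leftBlock, rightBlock, concat]

theorem concat_mul (v : Mat n d₁) (V : Mat n d₂) (x : Mat (d₁ + d₂) n) :
    concat v V * x = v * topBlock x + V * botBlock x := by
  ext i j
  simp [Matrix.mul_apply, Fin.sum_univ_add, concat, topBlock, botBlock]

theorem imTr_mul_concat (x : Mat (d₁ + d₂) n) (v : Mat n d₁) (V : Mat n d₂) :
    imTr (x * concat v V) = imTr (topBlock x * v) + imTr (botBlock x * V) := by
  rw [imTr_mul_comm, concat_mul, imTr_add, imTr_mul_comm v, imTr_mul_comm V]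

theorem imTr_mul_conjTranspose_blocks (x y : Mat (d₁ + d₂) n) :
    imTr (x * yᴴ) = imTr (topBlock x * (topBlock y)ᴴ) + imTr (botBlock x * (botBlock y)ᴴ) := by
  simp [imTr, Matrix.trace, Matrix.mul_apply, Fin.sum_univ_add, topBlock, botBlock]

/-- Of the two off-diagonal blocks of `projU B`, the lower one is that of `B`, and it determines the
upper one. -/
theorem imTr_mul_projU_blocks (x y : Mat (d₁ + d₂) n) (v : Mat n d₁) (V : Mat n d₂) :
    imTr (x * concat v V * projU (y * concat v V)) =
      imTr (topBlock x * v * projU (topBlock y * v))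
        + imTr (botBlock x * V * projU (botBlock y * V))
        + imTr (topBlock x * V * (botBlock y * v))
        - imTr (botBlock x * v * (botBlock y * v)ᴴ) := by
  have e1 : ∀ (x : Mat (d₁ + d₂) n) i j, (x * concat v V) (Fin.castAdd d₂ i) (Fin.castAdd d₂ j) =
      (topBlock x * v) i j := fun x i j => by simp [Matrix.mul_apply, concat, topBlock]
  have e2 : ∀ (x : Mat (d₁ + d₂) n) i j, (x * concat v V) (Fin.castAdd d₂ i) (Fin.natAdd d₁ j) =
      (topBlock x * V) i j := fun x i j => by simp [Matrix.mul_apply, concat, topBlock]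
  have e3 : ∀ (x : Mat (d₁ + d₂) n) i j, (x * concat v V) (Fin.natAdd d₁ i) (Fin.castAdd d₂ j) =
      (botBlock x * v) i j := fun x i j => by simp [Matrix.mul_apply, concat, botBlock]
  have e4 : ∀ (x : Mat (d₁ + d₂) n) i j, (x * concat v V) (Fin.natAdd d₁ i) (Fin.natAdd d₁ j) =
      (botBlock x * V) i j := fun x i j => by simp [Matrix.mul_apply, concat, botBlock]
  have p1 : ∀ i j, projU (y * concat v V) (Fin.castAdd d₂ i) (Fin.castAdd d₂ j) =
      projU (topBlock y * v) i j := fun i j => by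
    have hlt : ∀ i j : Fin d₁, Fin.castAdd d₂ i < Fin.castAdd d₂ j ↔ i < j := fun _ _ => Iff.rfl
    simp [projU, e1, hlt]
  have p4 : ∀ i j, projU (y * concat v V) (Fin.natAdd d₁ i) (Fin.natAdd d₁ j) =
      projU (botBlock y * V) i j := fun i j => by
    simp [projU, e4]
  have p3 : ∀ i j, projU (y * concat v V) (Fin.natAdd d₁ i) (Fin.castAdd d₂ j) =
      (botBlock y * v) i j := fun i j => by
    have h : Fin.castAdd d₂ j < Fin.natAdd d₁ i := by
      simp only [Fin.lt_def, Fin.val_castAdd, Fin.val_natAdd]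
      omega
    simp [projU, e3, h]
  have p2 : ∀ i j, projU (y * concat v V) (Fin.castAdd d₂ i) (Fin.natAdd d₁ j) =
      -star ((botBlock y * v) j i) := fun i j => by
    have h : Fin.castAdd d₂ i < Fin.natAdd d₁ j := by
      simp only [Fin.lt_def, Fin.val_castAdd, Fin.val_natAdd]
      omega
    simp [projU, e3, h, h.not_gt]
  have h : ∀ A B : Mat (d₁ + d₂) (d₁ + d₂), Matrix.trace (A * B) =
      ((∑ i, ∑ j, A (Fin.castAdd d₂ i) (Fin.castAdd d₂ j) * B (Fin.castAdd d₂ j) (Fin.castAdd d₂ i))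
      + ∑ i, ∑ j, A (Fin.castAdd d₂ i) (Fin.natAdd d₁ j) * B (Fin.natAdd d₁ j) (Fin.castAdd d₂ i))
      + ((∑ i, ∑ j, A (Fin.natAdd d₁ i) (Fin.castAdd d₂ j) * B (Fin.castAdd d₂ j) (Fin.natAdd d₁ i))
      + ∑ i, ∑ j, A (Fin.natAdd d₁ i) (Fin.natAdd d₁ j) * B (Fin.natAdd d₁ j) (Fin.natAdd d₁ i)) := by
    intro A B
    simp only [Matrix.trace, Matrix.diag_apply, Matrix.mul_apply, Fin.sum_univ_add,
      Finset.sum_add_distrib]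
    ring
  have h' : ∀ {k l : ℕ} (A : Mat k l) (B : Mat l k), ∑ i, ∑ j, A i j * B j i =
      Matrix.trace (A * B) := fun A B => by
    simp only [Matrix.trace, Matrix.diag_apply, Matrix.mul_apply]
  have h'' : ∀ {k l : ℕ} (A B : Mat k l), ∑ i, ∑ j, A i j * -star (B i j) =
      -Matrix.trace (A * Bᴴ) := fun A B => by
    simp only [Matrix.trace, Matrix.diag_apply, Matrix.mul_apply, Matrix.conjTranspose_apply,
      mul_neg, Finset.sum_neg_distrib]
  rw [imTr, h]
  simp only [e1, e2, e3, e4, p1, p2, p3, p4, h', h'', imTr, Complex.add_im, Complex.neg_im]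
  ring

theorem zakBivector_apply {d : ℕ} (lam : ℝ) (v : Mat n d) (x y : Mat d n) :
    zakBivector lam v x y = imTr (v * x * projU (v * y)) + imTr (x * v * projU (y * v))
      - imTr (v * x * (v * y)) - lam * imTr (x * yᴴ) := by
  have e : imTr (x * v * y * v) = imTr (v * x * (v * y)) := by
    rw [imTr_mul_comm]
    simp only [Matrix.mul_assoc]
  rw [← e]
  rfl

theorem zakBivector_concat (lam : ℝ) (v : Mat n d₁) (U : Mat n d₂) (x y : Mat (d₁ + d₂) n) :
    zakBivector lam (concat v U) x y =
      imTr ((v * topBlock x + U * botBlock x) * projU (v * topBlock y + U * botBlock y))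
        + imTr (topBlock x * v * projU (topBlock y * v))
        + imTr (botBlock x * U * projU (botBlock y * U))
        + imTr (v * topBlock x * (U * botBlock y))
        - imTr (botBlock x * (v * vᴴ) * (botBlock y)ᴴ)
        - imTr ((v * topBlock x + U * botBlock x) * (v * topBlock y + U * botBlock y))
        - lam * (imTr (topBlock x * (topBlock y)ᴴ) + imTr (botBlock x * (botBlock y)ᴴ)) := by
  have e1 : imTr (topBlock x * U * (botBlock y * v)) = imTr (v * topBlock x * (U * botBlock y)) := by
    rw [← Matrix.mul_assoc, imTr_mul_comm]
    simp only [Matrix.mul_assoc]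
  have e2 : imTr (botBlock x * v * (botBlock y * v)ᴴ) =
      imTr (botBlock x * (v * vᴴ) * (botBlock y)ᴴ) := by
    rw [Matrix.conjTranspose_mul]
    simp only [Matrix.mul_assoc]
  rw [zakBivector_apply, imTr_mul_projU_blocks, imTr_mul_conjTranspose_blocks, concat_mul,
    concat_mul, e1, e2]
  ring

end Blocks

/-! ### The pullback of the bivector under `Σ` -/

section Pullback

variable {n d₁ d₂ : ℕ}

/-- The skew-Hermitian matrix `Q = b⁻† (V X b)_𝔨 b⁻¹`. Pulling back by `Σ` changes the component in
`v` of a covector with components `x`, `X` to `x + v† Q`. -/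
noncomputable def pullSkew (b : Mat n n) (V : Mat n d₂) (X : Mat d₂ n) : Mat n n :=
  b⁻¹ᴴ * projU (V * X * b) * b⁻¹

theorem pullSkew_inU (b : Mat n n) (V : Mat n d₂) (X : Mat d₂ n) : InU (pullSkew b V X) := by
  have := (projU_inU (V * X * b)).conj b⁻¹ᴴ
  rwa [Matrix.conjTranspose_conjTranspose] at this

theorem mul_conjTranspose_pullSkew {b : Mat n n} (hb : IsUnit b.det) (V : Mat n d₂)
    (X : Mat d₂ n) : b * bᴴ * pullSkew b V X = b * projU (V * X * b) * b⁻¹ := by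
  have h : b * bᴴ * pullSkew b V X = b * (bᴴ * b⁻¹ᴴ) * projU (V * X * b) * b⁻¹ := by
    simp only [pullSkew, Matrix.mul_assoc]
  rw [h, conjTranspose_nonsing_inv_mul hb, Matrix.mul_one]

/-- The contribution of the derivative `β` of `b` to the pullback of a covector. Only the
skew-Hermitian part of `V X b` is seen by `b⁻¹ β ∈ b(n)`, and it is paired with the Hermitian part
of `b⁻¹ β`, which the derivative of `b b†` determines. -/
theorem imTr_mul_deriv_borel {b β : Mat n n} (hb : b ∈ BorelGroup n) (hβ : InB β)
    {v w : Mat n d₁} (h : b * βᴴ + β * bᴴ = v * wᴴ + w * vᴴ) (V : Mat n d₂) (X : Mat d₂ n) :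
    imTr (X * (β * V)) = imTr (vᴴ * pullSkew b V X * w) := by
  have hu := isUnit_det_of_mem_borelGroup hb
  set A := V * X * b with hA
  set Q := pullSkew b V X with hQdef
  have hQ : InU Q := pullSkew_inU b V X
  have hB : InB (b⁻¹ * β) := (inB_of_mem_borelGroup (inv_mem_borelGroup hb)).mul hβ
  have e1 : imTr (X * (β * V)) = imTr (A * (b⁻¹ * β)) := by
    rw [← Matrix.mul_assoc, imTr_mul_comm, hA, Matrix.mul_assoc (V * X),
      Matrix.mul_nonsing_inv_cancel_left b β hu, Matrix.mul_assoc]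
  have e2 : imTr (A * (b⁻¹ * β)) = imTr (projU A * (b⁻¹ * β)) := by
    have := (sub_projU_inB A).imTr_mul hB
    rw [Matrix.sub_mul, imTr_sub] at this
    linarith
  have e3 : imTr (projU A * (b⁻¹ * β)) = imTr (Q * (β * bᴴ)) := by
    rw [hQdef, pullSkew, ← hA, imTr_mul_comm (_ * b⁻¹), Matrix.mul_assoc β, ← Matrix.mul_assoc bᴴ,
      ← Matrix.mul_assoc bᴴ, conjTranspose_nonsing_inv_mul hu, Matrix.one_mul, ← Matrix.mul_assoc,
      imTr_mul_comm β]
  have e4 : imTr (Q * (b * βᴴ)) = imTr (Q * (β * bᴴ)) := by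
    rw [← hQ.imTr_mul_conjTranspose (β * bᴴ), Matrix.conjTranspose_mul,
      Matrix.conjTranspose_conjTranspose]
  have e5 : imTr (Q * (v * wᴴ)) = imTr (Q * (w * vᴴ)) := by
    rw [← hQ.imTr_mul_conjTranspose (w * vᴴ), Matrix.conjTranspose_mul,
      Matrix.conjTranspose_conjTranspose]
  have e6 : imTr (Q * (w * vᴴ)) = imTr (vᴴ * Q * w) := by
    rw [← Matrix.mul_assoc, imTr_mul_rotate]
  have e7 := congrArg (fun Z => imTr (Q * Z)) h
  simp only [Matrix.mul_add, imTr_add] at e7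
  linarith

/-- `Σ` maps the direct sum bivector to the Zakrzewski bivector, at the level of covectors. -/
theorem zakBivector_pullback {lam : ℝ} {v : Mat n d₁} {b : Mat n n} (hb : b ∈ BorelGroup n)
    (hbm : b * bᴴ = momentum lam v) (V : Mat n d₂) (x y : Mat (d₁ + d₂) n) :
    zakBivector lam v (topBlock x + vᴴ * pullSkew b V (botBlock x))
        (topBlock y + vᴴ * pullSkew b V (botBlock y))
      + zakBivector 1 V (botBlock x * b) (botBlock y * b) =
    zakBivector lam (concat v (b * V)) x y := by
  have hu := isUnit_det_of_mem_borelGroup hb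
  rw [zakBivector_concat]
  set X := botBlock x
  set Y := botBlock y
  set x := topBlock x
  set y := topBlock y
  set q := pullSkew b V X
  set r := pullSkew b V Y
  have hqU : InU q := pullSkew_inU b V X
  have hrU : InU r := pullSkew_inU b V Y
  have hvv : v * vᴴ = b * bᴴ - lam • (1 : Mat n n) := by
    rw [hbm, momentum, Complex.coe_smul, add_sub_cancel_left]
  have hvvq : ∀ Z : Mat n n, v * vᴴ * Z = b * bᴴ * Z - lam • Z := fun Z => by
    rw [hvv, Matrix.sub_mul, Matrix.smul_mul, Matrix.one_mul]
  have hUX : ∀ X : Mat d₂ n, b * V * X = b * (V * X * b) * b⁻¹ := fun X => by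
    rw [← Matrix.mul_assoc, Matrix.mul_nonsing_inv_cancel_right b _ hu, Matrix.mul_assoc]
  set A := V * X * b with hA
  set B := V * Y * b with hB
  -- `k`, `l` are the conjugates by `b` of the skew-Hermitian parts of `A`, `B`
  set k := b * projU A * b⁻¹ with hk
  set l := b * projU B * b⁻¹ with hl
  have hMq : b * bᴴ * q = k := mul_conjTranspose_pullSkew hu V X
  have hMr : b * bᴴ * r = l := mul_conjTranspose_pullSkew hu V Y
  have hconj : ∀ C D : Mat n n, imTr (b * C * b⁻¹ * (b * D * b⁻¹)) = imTr (C * D) := fun C D => by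
    rw [imTr_mul_comm, Matrix.mul_assoc (b * D), ← Matrix.mul_assoc b⁻¹, ← Matrix.mul_assoc b⁻¹,
      Matrix.nonsing_inv_mul b hu, Matrix.one_mul, Matrix.mul_assoc b, imTr_mul_comm b]
    rw [← Matrix.mul_assoc D, Matrix.mul_assoc _ b⁻¹, Matrix.nonsing_inv_mul b hu, Matrix.mul_one,
      imTr_mul_comm]
  have hkA : InB (b * A * b⁻¹ - k) := by
    have := (sub_projU_inB A).conj_borel hb
    rwa [Matrix.mul_sub, Matrix.sub_mul] at this
  have hlB : InB (b * B * b⁻¹ - l) := by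
    have := (sub_projU_inB B).conj_borel hb
    rwa [Matrix.mul_sub, Matrix.sub_mul] at this
  have hPl : projU (b * B * b⁻¹) = projU l := by
    have := hlB.projU_eq
    rwa [projU_sub, sub_eq_zero] at this
  -- the momentum of the pulled back covectors
  have hvx : v * (x + vᴴ * q) = v * x + k - lam • q := by
    rw [Matrix.mul_add, ← Matrix.mul_assoc, hvvq, hMq, add_sub_assoc]
  have hvy : v * (y + vᴴ * r) = v * y + l - lam • r := by
    rw [Matrix.mul_add, ← Matrix.mul_assoc, hvvq, hMr, add_sub_assoc]
  have hqv : InU (vᴴ * q * v) := by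
    have := hqU.conj vᴴ
    rwa [Matrix.conjTranspose_conjTranspose] at this
  have hrv : InU (vᴴ * r * v) := by
    have := hrU.conj vᴴ
    rwa [Matrix.conjTranspose_conjTranspose] at this
  have t2 : imTr ((x + vᴴ * q) * v * projU ((y + vᴴ * r) * v)) =
      imTr (x * v * projU (y * v)) + imTr (v * x * l) - lam * imTr (v * x * r) := by
    have e : imTr (x * v * (vᴴ * r * v)) = imTr (v * x * l) - lam * imTr (v * x * r) := by
      rw [← Matrix.mul_assoc, imTr_mul_comm, ← imTr_smul, ← imTr_sub, ← Matrix.mul_smul,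
        ← Matrix.mul_sub, ← hMr, ← hvvq]
      simp only [Matrix.mul_assoc]
    rw [Matrix.add_mul x, Matrix.add_mul y, projU_add, hrv.projU_eq, Matrix.add_mul, Matrix.mul_add,
      Matrix.mul_add, imTr_add, imTr_add, imTr_add, hqv.imTr_mul hrv,
      hqv.imTr_mul (projU_inU _), e]
    ring
  have t4 : imTr ((x + vᴴ * q) * (y + vᴴ * r)ᴴ) =
      imTr (x * yᴴ) - imTr (v * x * r) + imTr (q * (v * y)) - imTr (k * r) := by
    have e1 : imTr (x * (r * v)) = imTr (v * x * r) := by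
      rw [← Matrix.mul_assoc, imTr_mul_rotate]
    have e2 : imTr (vᴴ * q * yᴴ) = imTr (q * (v * y)) := by
      rw [imTr_mul_rotate, imTr_mul_comm, ← Matrix.conjTranspose_mul, hqU.imTr_mul_conjTranspose]
    have e3 : imTr (vᴴ * q * (r * v)) = imTr (k * r) := by
      rw [← Matrix.mul_assoc, imTr_mul_rotate, ← Matrix.mul_assoc, hvvq, hMq, Matrix.sub_mul,
        imTr_sub, Matrix.smul_mul, imTr_smul, hqU.imTr_mul hrU, mul_zero, sub_zero]
    rw [Matrix.conjTranspose_add, Matrix.conjTranspose_mul, hrU.conjTranspose_eq,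
      Matrix.conjTranspose_conjTranspose, Matrix.neg_mul]
    simp only [Matrix.add_mul, Matrix.mul_add, Matrix.mul_neg, imTr_add, imTr_neg, e1, e2, e3]
    ring
  have hql : imTr (q * l) = -imTr (k * r) := by
    have e := imTr_conjTranspose (q * l)
    rw [← hMr, Matrix.conjTranspose_mul, Matrix.conjTranspose_mul, Matrix.conjTranspose_mul,
      Matrix.conjTranspose_conjTranspose, hqU.conjTranspose_eq, hrU.conjTranspose_eq,
      Matrix.mul_neg, Matrix.neg_mul, Matrix.neg_mul, neg_neg, hMr, Matrix.mul_assoc, hMq,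
      imTr_mul_comm r] at e
    linarith
  have hXY : imTr (X * (v * vᴴ) * Yᴴ) = imTr (X * b * (Y * b)ᴴ) - lam * imTr (X * Yᴴ) := by
    rw [hvv, Matrix.mul_sub, Matrix.sub_mul, imTr_sub, Matrix.mul_smul, Matrix.smul_mul, imTr_smul,
      Matrix.mul_one, Matrix.conjTranspose_mul]
    simp only [Matrix.mul_assoc]
  have hkl : imTr (k * l) = 0 := by
    rw [hk, hl, hconj, (projU_inU A).imTr_mul (projU_inU B)]
  have hαl : imTr (b * A * b⁻¹ * l) = imTr (A * projU B) := hconj _ _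
  have hαγ : imTr (b * A * b⁻¹ * (b * B * b⁻¹)) = imTr (A * B) := hconj _ _
  have o1 := hqU.imTr_mul hrU
  have o2 := hqU.imTr_mul (projU_inU (v * y))
  have o3 := hqU.imTr_mul (projU_inU l)
  have o4 := hkA.imTr_mul (sub_projU_inB (v * y))
  have o5 := hkA.imTr_mul (sub_projU_inB l)
  rw [zakBivector_apply, zakBivector_apply, hvx, hvy, t2, t4, hUX X, hUX Y, hXY, projU_sub,
    projU_add, projU_smul, hrU.projU_eq, projU_add, hPl]
  have hXb : V * (X * b) = A := (Matrix.mul_assoc _ _ _).symm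
  have hYb : V * (Y * b) = B := (Matrix.mul_assoc _ _ _).symm
  have hXV : X * (b * V) = X * b * V := (Matrix.mul_assoc _ _ _).symm
  have hYV : Y * (b * V) = Y * b * V := (Matrix.mul_assoc _ _ _).symm
  rw [hXb, hYb, hXV, hYV]
  simp only [Matrix.mul_add, Matrix.add_mul, Matrix.mul_sub, Matrix.sub_mul, imTr_add, imTr_sub,
    Matrix.mul_smul, Matrix.smul_mul, imTr_smul, o1, o2, o3, hql, hkl, hαl] at o4 o5 ⊢
  linarith

end Pullback

/-! ### `Σ` as a Poisson isomorphism -/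

section General

variable {E F G : Type*} [NormedAddCommGroup E] [NormedSpace ℝ E] [NormedAddCommGroup F]
  [NormedSpace ℝ F] [NormedAddCommGroup G] [NormedSpace ℝ G]

theorem normFDeriv_comp {g : F → G} {f : E → F} {x : E} (hg : ContDiffAt ℝ ∞ g (f x))
    (hf : ContDiffAt ℝ ∞ f x) (w : E) :
    normFDeriv (fun y => g (f y)) x w = normFDeriv g (f x) (normFDeriv f x w) := by
  have h : HasFDerivAt (fun y => g (f y)) ((fderiv ℝ g (f x)).comp (fderiv ℝ f x)) x :=
    (hg.differentiableAt (by simp)).hasFDerivAt.comp x (hf.differentiableAt (by simp)).hasFDerivAt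
  rw [normFDeriv, h.fderiv]
  rfl

theorem normFDeriv_clm_self (L : E →L[ℝ] F) (x : E) : normFDeriv (fun y => L y) x = L := L.fderiv

theorem normFDeriv_prod_left {g : E × F → G} {p : E × F} (hg : ContDiffAt ℝ ∞ g p) :
    normFDeriv (fun m => g (m, p.2)) p.1 = (normFDeriv g p).comp (.inl ℝ E F) := by
  have h : HasFDerivAt (fun m => g (m, p.2)) ((fderiv ℝ g p).comp (.inl ℝ E F)) p.1 :=
    (hg.differentiableAt (by simp)).hasFDerivAt.comp (f := fun m => (m, p.2)) p.1
      (hasFDerivAt_prodMk_left p.1 p.2)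
  exact h.fderiv

theorem normFDeriv_prod_right {g : E × F → G} {p : E × F} (hg : ContDiffAt ℝ ∞ g p) :
    normFDeriv (fun m => g (p.1, m)) p.2 = (normFDeriv g p).comp (.inr ℝ E F) := by
  have h : HasFDerivAt (fun m => g (p.1, m)) ((fderiv ℝ g p).comp (.inr ℝ E F)) p.2 :=
    (hg.differentiableAt (by simp)).hasFDerivAt.comp (f := fun m => (p.1, m)) p.2
      (hasFDerivAt_prodMk_right p.1 p.2)
  exact h.fderiv

end General

section Sigma

variable {n d₁ d₂ : ℕ}

theorem directSum_isPoissonBracketOn (lam mu : ℝ) {U : Set (Mat n d₁ × Mat n d₂)} (hU : IsOpen U) :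
    IsPoissonBracketOn U (directSumBracket (zakBracket n d₁ lam) (zakBracket n d₂ mu)) := by
  refine ((zakSharp_poissonAnchor n d₁ lam).prod (zakSharp_poissonAnchor n d₂ mu)).isPoissonBracketOn
    hU fun F H hF hH p hp => ?_
  have hF' := hF.contDiffAt (hU.mem_nhds hp)
  have hH' := hH.contDiffAt (hU.mem_nhds hp)
  rw [directSumBracket, zakBracket_eq, zakBracket_eq, normFDeriv_prod_left hF',
    normFDeriv_prod_left hH', normFDeriv_prod_right hF', normFDeriv_prod_right hH']
  simp [normFDeriv, ← map_add]

/-- `concat` as a continuous real-linear map. -/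
noncomputable def concatL (n d₁ d₂ : ℕ) : NormedMap (Mat n d₁ × Mat n d₂) (Mat n (d₁ + d₂)) :=
  LinearMap.toContinuousLinearMap
    { toFun := fun p => concat p.1 p.2
      map_add' := fun p q => by
        ext i j
        refine Fin.addCases (fun j => ?_) (fun j => ?_) j <;> simp [concat]
      map_smul' := fun c p => by
        ext i j
        refine Fin.addCases (fun j => ?_) (fun j => ?_) j <;> simp [concat] }

/-- `leftBlock` as a continuous real-linear map. -/
noncomputable def leftBlockL (n d₁ d₂ : ℕ) : NormedMap (Mat n (d₁ + d₂)) (Mat n d₁) :=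
  LinearMap.toContinuousLinearMap
    { toFun := leftBlock
      map_add' := fun _ _ => rfl
      map_smul' := fun _ _ => rfl }

/-- `rightBlock` as a continuous real-linear map. -/
noncomputable def rightBlockL (n d₁ d₂ : ℕ) : NormedMap (Mat n (d₁ + d₂)) (Mat n d₂) :=
  LinearMap.toContinuousLinearMap
    { toFun := rightBlock
      map_add' := fun _ _ => rfl
      map_smul' := fun _ _ => rfl }

/-- The inverse of `Σ`. -/
noncomputable def sigmaInv (n d₁ d₂ : ℕ) (lam : ℝ) (W : Mat n (d₁ + d₂)) : Mat n d₁ × Mat n d₂ :=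
  (leftBlock W, (bOf lam (leftBlock W))⁻¹ * rightBlock W)

theorem sigmaInv_sigmaMap {lam : ℝ} {p : Mat n d₁ × Mat n d₂} (hp : p.1 ∈ posDomain n d₁ lam) :
    sigmaInv n d₁ d₂ lam (sigmaMap n d₁ d₂ lam p) = p := by
  rw [sigmaInv, sigmaMap, leftBlock_concat, rightBlock_concat,
    Matrix.nonsing_inv_mul_cancel_left _ _ (isUnit_det_of_mem_borelGroup (bOf_spec hp).1)]

theorem sigmaMap_sigmaInv {lam : ℝ} {W : Mat n (d₁ + d₂)}
    (hW : leftBlock W ∈ posDomain n d₁ lam) :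
    sigmaMap n d₁ d₂ lam (sigmaInv n d₁ d₂ lam W) = W := by
  rw [sigmaInv, sigmaMap,
    Matrix.mul_nonsing_inv_cancel_left _ _ (isUnit_det_of_mem_borelGroup (bOf_spec hW).1),
    concat_blocks]

theorem contDiffAt_sigmaMap {lam : ℝ} {p : Mat n d₁ × Mat n d₂}
    (hp : p.1 ∈ posDomain n d₁ lam) : ContDiffAt ℝ ∞ (sigmaMap n d₁ d₂ lam) p := by
  have hb : ContDiffAt ℝ ∞ (fun p : Mat n d₁ × Mat n d₂ => bOf lam p.1) p :=
    (contDiffAt_bOf hp).comp p contDiffAt_fst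
  exact (concatL n d₁ d₂).contDiff.contDiffAt.comp p
    (contDiffAt_fst.prodMk (contDiffAt_mul hb contDiffAt_snd))

theorem contDiffAt_sigmaInv {lam : ℝ} {W : Mat n (d₁ + d₂)}
    (hW : leftBlock W ∈ posDomain n d₁ lam) : ContDiffAt ℝ ∞ (sigmaInv n d₁ d₂ lam) W := by
  have hl : ContDiffAt ℝ ∞ (fun W : Mat n (d₁ + d₂) => (leftBlock W : Mat n d₁)) W :=
    (leftBlockL n d₁ d₂).contDiff.contDiffAt
  have hr : ContDiffAt ℝ ∞ (fun W : Mat n (d₁ + d₂) => (rightBlock W : Mat n d₂)) W :=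
    (rightBlockL n d₁ d₂).contDiff.contDiffAt
  have hb : ContDiffAt ℝ ∞ (fun W : Mat n (d₁ + d₂) => bOf lam (leftBlock W : Mat n d₁)) W :=
    (contDiffAt_bOf hW).comp W hl
  refine hl.prodMk (contDiffAt_inv_mul hb hr ?_)
  filter_upwards [hl.continuousAt.eventually ((isOpen_posDomain n d₁ lam).mem_nhds hW)] with Z hZ
  exact isUnit_det_of_mem_borelGroup (bOf_spec hZ).1

/-- The differentials of `F ∘ Σ` in its two arguments. -/
theorem diff_comp_sigmaMap {lam : ℝ} {p : Mat n d₁ × Mat n d₂} (hp : p.1 ∈ posDomain n d₁ lam)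
    {F : Mat n (d₁ + d₂) → ℝ} (hF : ContDiffAt ℝ ∞ F (sigmaMap n d₁ d₂ lam p)) :
    diff (fun m => (F ∘ sigmaMap n d₁ d₂ lam) (m, p.2)) p.1 =
        topBlock (diff F (sigmaMap n d₁ d₂ lam p)) +
          p.1ᴴ * pullSkew (bOf lam p.1) p.2 (botBlock (diff F (sigmaMap n d₁ d₂ lam p))) ∧
      diff (fun m => (F ∘ sigmaMap n d₁ d₂ lam) (p.1, m)) p.2 =
        botBlock (diff F (sigmaMap n d₁ d₂ lam p)) * bOf lam p.1 := by
  obtain ⟨v, V⟩ := p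
  have hb := contDiffAt_bOf hp
  have hid : ContDiffAt ℝ ∞ (fun u : Mat n d₁ => u) v := contDiffAt_id
  have hV : ContDiffAt ℝ ∞ (fun _ : Mat n d₁ => V) v := contDiffAt_const
  constructor
  · refine covMat_eq_of_imTr fun w => ?_
    have hm := contDiffAt_mul hb hV
    have e : normFDeriv (fun m : Mat n d₁ => concat m (bOf lam m * V)) v w =
        concat w (normFDeriv (fun m : Mat n d₁ => bOf lam m) v w * V) := by
      have h1 := normFDeriv_clm (concatL n d₁ d₂) (hid.prodMk hm) w
      have h2 : normFDeriv (fun m : Mat n d₁ => (m, bOf lam m * V)) v w =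
          (w, normFDeriv (fun m : Mat n d₁ => bOf lam m) v w * V) := by
        have h3 := normFDeriv_mul hb hV w
        rw [normFDeriv_const, Matrix.mul_zero, zero_add] at h3
        rw [← h3, normFDeriv, DifferentiableAt.fderiv_prodMk (hid.differentiableAt (by simp))
          (hm.differentiableAt (by simp))]
        simp [normFDeriv]
      rw [h2] at h1
      exact h1
    have h4 := normFDeriv_comp (f := fun m : Mat n d₁ => concat m (bOf lam m * V)) hF
      ((concatL n d₁ d₂).contDiff.contDiffAt.comp v (hid.prodMk hm)) w
    refine h4.trans ?_
    obtain ⟨hβ, hβ'⟩ := normFDeriv_bOf hp w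
    rw [e, apply_eq_imTr, ← diff_eq_covMat, imTr_mul_concat,
      imTr_mul_deriv_borel (bOf_spec hp).1 hβ hβ', Matrix.add_mul, imTr_add]
    rfl
  · refine covMat_eq_of_imTr fun w => ?_
    have hid' : ContDiffAt ℝ ∞ (fun u : Mat n d₂ => u) V := contDiffAt_id
    have hc : ContDiffAt ℝ ∞ (fun _ : Mat n d₂ => v) V := contDiffAt_const
    have hcb : ContDiffAt ℝ ∞ (fun _ : Mat n d₂ => bOf lam v) V := contDiffAt_const
    have hm := contDiffAt_mul hcb hid'
    have e : normFDeriv (fun m : Mat n d₂ => concat v (bOf lam v * m)) V w =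
        concat 0 (bOf lam v * w) := by
      have h1 := normFDeriv_clm (concatL n d₁ d₂) (hc.prodMk hm) w
      have h2 : normFDeriv (fun m : Mat n d₂ => (v, bOf lam v * m)) V w = (0, bOf lam v * w) := by
        have h3 := normFDeriv_mul hcb hid' w
        rw [normFDeriv_const, Matrix.zero_mul, add_zero, normFDeriv_id] at h3
        rw [← h3, normFDeriv, DifferentiableAt.fderiv_prodMk (hc.differentiableAt (by simp))
          (hm.differentiableAt (by simp))]
        simp [normFDeriv]
      rw [h2] at h1
      exact h1
    have h4 := normFDeriv_comp (f := fun m : Mat n d₂ => concat v (bOf lam v * m)) hF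
      ((concatL n d₁ d₂).contDiff.contDiffAt.comp V (hc.prodMk hm)) w
    refine h4.trans ?_
    rw [e, apply_eq_imTr, ← diff_eq_covMat, imTr_mul_concat, Matrix.mul_zero, Matrix.mul_assoc]
    simp only [imTr, Matrix.trace_zero, Complex.zero_im, zero_add]
    rfl

theorem sigmaMap_isPoissonIso (n d₁ d₂ : ℕ) (lam : ℝ) :
    IsPoissonIso (posDomain n d₁ lam ×ˢ (Set.univ : Set (Mat n d₂)))
      (directSumBracket (zakBracket n d₁ lam) (zakBracket n d₂ 1))
      (leftBlock ⁻¹' posDomain n d₁ lam) (zakBracket n (d₁ + d₂) lam)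
      (sigmaMap n d₁ d₂ lam) := by
  have hU : IsOpen (posDomain n d₁ lam ×ˢ (Set.univ : Set (Mat n d₂))) :=
    (isOpen_posDomain n d₁ lam).prod isOpen_univ
  have hU' : IsOpen (leftBlock (d₂ := d₂) ⁻¹' posDomain n d₁ lam) :=
    (isOpen_posDomain n d₁ lam).preimage (leftBlockL n d₁ d₂).continuous
  have hmaps : Set.MapsTo (sigmaMap n d₁ d₂ lam) (posDomain n d₁ lam ×ˢ Set.univ)
      (leftBlock ⁻¹' posDomain n d₁ lam) := fun p hp => by
    rw [Set.mem_preimage, sigmaMap, leftBlock_concat]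
    exact hp.1
  refine ⟨directSum_isPoissonBracketOn lam 1 hU, zakBracket_isPoissonBracketOn lam hU',
    ?_, ?_, ?_, ?_⟩
  · exact Set.BijOn.mk hmaps (Set.LeftInvOn.injOn fun p hp => sigmaInv_sigmaMap hp.1)
      fun W hW => ⟨sigmaInv n d₁ d₂ lam W, ⟨hW, Set.mem_univ _⟩, sigmaMap_sigmaInv hW⟩
  · exact fun p hp => (contDiffAt_sigmaMap hp.1).contDiffWithinAt
  · exact ⟨sigmaInv n d₁ d₂ lam, fun p hp => sigmaInv_sigmaMap hp.1,
      fun W hW => (contDiffAt_sigmaInv hW).contDiffWithinAt⟩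
  · intro F H hF hH p hp
    obtain ⟨hF1, hF2⟩ := diff_comp_sigmaMap hp.1 (hF.contDiffAt (hU'.mem_nhds (hmaps hp)))
    obtain ⟨hH1, hH2⟩ := diff_comp_sigmaMap hp.1 (hH.contDiffAt (hU'.mem_nhds (hmaps hp)))
    obtain ⟨hb, hbm⟩ := bOf_spec hp.1
    rw [directSumBracket, zakBracket, zakBracket, hF1, hF2, hH1, hH2]
    exact zakBivector_pullback hb hbm p.2 _ _

/-- `linFun X` as a continuous real-linear map. -/
noncomputable def linFunL {d : ℕ} (X : Mat n d) : NormedMap (Mat n d) ℝ :=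
  LinearMap.toContinuousLinearMap
    { toFun := linFun X
      map_add' := fun W Z => by simp [linFun, Matrix.mul_add, Matrix.trace_add]
      map_smul' := fun c W => by simp [linFun, Matrix.trace_smul] }

theorem diff_linFun {d : ℕ} (X v : Mat n d) : diff (linFun X) v = Xᴴ :=
  covMat_eq_of_imTr fun w => DFunLike.congr_fun (normFDeriv_clm_self (linFunL X) v) w

theorem contDiff_linFun {d : ℕ} (X : Mat n d) : ContDiff ℝ ∞ (linFun X) :=
  (linFunL X).contDiff

end Sigma

end ZakPoisson

open ZakPoisson in
theorem proposition5p1 (n d₁ d₂ : ℕ) (lam : ℝ) :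
    -- for positive `lam` the domain is the whole space
    (0 < lam → ZakPoisson.posDomain n d₁ lam = Set.univ) ∧
    -- `b(v)` is well defined
    (∀ v ∈ ZakPoisson.posDomain n d₁ lam,
      (∃! b, b ∈ ZakPoisson.BorelGroup n ∧ b * bᴴ = ZakPoisson.momentum lam v) ∧
      ZakPoisson.bOf lam v ∈ ZakPoisson.BorelGroup n ∧
      ZakPoisson.bOf lam v * (ZakPoisson.bOf lam v)ᴴ = ZakPoisson.momentum lam v) ∧
    -- `Σ` is a Poisson isomorphism onto its image with the Zakrzewski bracket of parameter `lam`
    ZakPoisson.IsPoissonIso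
      (ZakPoisson.posDomain n d₁ lam ×ˢ (Set.univ : Set (ZakPoisson.Mat n d₂)))
      (ZakPoisson.directSumBracket
        (ZakPoisson.zakBracket n d₁ lam) (ZakPoisson.zakBracket n d₂ 1))
      (ZakPoisson.leftBlock ⁻¹' ZakPoisson.posDomain n d₁ lam)
      (ZakPoisson.zakBracket n (d₁ + d₂) lam)
      (ZakPoisson.sigmaMap n d₁ d₂ lam) ∧
    -- any bracket for which `Σ` is a Poisson isomorphism is that bracket
    ∀ br : (ZakPoisson.Mat n (d₁ + d₂) → ℝ) → (ZakPoisson.Mat n (d₁ + d₂) → ℝ) →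
        ZakPoisson.Mat n (d₁ + d₂) → ℝ,
      ZakPoisson.IsPoissonIso
        (ZakPoisson.posDomain n d₁ lam ×ˢ (Set.univ : Set (ZakPoisson.Mat n d₂)))
        (ZakPoisson.directSumBracket
          (ZakPoisson.zakBracket n d₁ lam) (ZakPoisson.zakBracket n d₂ 1))
        (ZakPoisson.leftBlock ⁻¹' ZakPoisson.posDomain n d₁ lam) br
        (ZakPoisson.sigmaMap n d₁ d₂ lam) →
      (∀ F H : ZakPoisson.Mat n (d₁ + d₂) → ℝ,
        ContDiffOn ℝ ∞ F (ZakPoisson.leftBlock ⁻¹' ZakPoisson.posDomain n d₁ lam) →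
        ContDiffOn ℝ ∞ H (ZakPoisson.leftBlock ⁻¹' ZakPoisson.posDomain n d₁ lam) →
        Set.EqOn (br F H) (ZakPoisson.zakBracket n (d₁ + d₂) lam F H)
          (ZakPoisson.leftBlock ⁻¹' ZakPoisson.posDomain n d₁ lam)) ∧
      ∀ X Y W : ZakPoisson.Mat n (d₁ + d₂),
        W ∈ ZakPoisson.leftBlock ⁻¹' ZakPoisson.posDomain n d₁ lam →
        br (ZakPoisson.linFun X) (ZakPoisson.linFun Y) W =
          (Matrix.trace (W * Xᴴ * ZakPoisson.projU (W * Yᴴ))).im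
            + (Matrix.trace (Xᴴ * W * ZakPoisson.projU (Yᴴ * W))).im
            - (Matrix.trace (W * Xᴴ * W * Yᴴ)).im
            - lam * (Matrix.trace (Xᴴ * Y)).im := by
  refine ⟨posDomain_eq_univ, fun v hv => ⟨?_, bOf_spec hv⟩, sigmaMap_isPoissonIso n d₁ d₂ lam,
    fun br hbr => ?_⟩
  · exact ⟨bOf lam v, bOf_spec hv, fun c hc =>
      eq_of_mul_conjTranspose_eq hc.1 (bOf_spec hv).1 (hc.2.trans (bOf_spec hv).2.symm)⟩
  · have hS := sigmaMap_isPoissonIso n d₁ d₂ lam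
    have huniq : ∀ F H : Mat n (d₁ + d₂) → ℝ,
        ContDiffOn ℝ ∞ F (leftBlock ⁻¹' posDomain n d₁ lam) →
        ContDiffOn ℝ ∞ H (leftBlock ⁻¹' posDomain n d₁ lam) →
        Set.EqOn (br F H) (zakBracket n (d₁ + d₂) lam F H)
          (leftBlock ⁻¹' posDomain n d₁ lam) := by
      intro F H hF hH W hW
      obtain ⟨p, hp, rfl⟩ := hS.bijOn.surjOn hW
      rw [← hbr.map_bracket F H hF hH p hp, hS.map_bracket F H hF hH p hp]
    refine ⟨huniq, fun X Y W hW => ?_⟩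
    rw [huniq _ _ (contDiff_linFun X).contDiffOn (contDiff_linFun Y).contDiffOn hW, zakBracket,
      diff_linFun, diff_linFun, zakBivector_apply, Matrix.conjTranspose_conjTranspose,
      ← Matrix.mul_assoc (W * Xᴴ)]
    rfl
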